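/- **Setting.** Let $d\ge 1$. A state is a positive semidefinite matrix $\rho\in\mathbb C^{d\times d}$ with $\operatorname{Tr}\rho=1$, and $\rho_{\mathrm{mm}}=\mathbb I_d/d$. A POVM is a finite or countable family $\mathcal M=\{M_x\}_x$ of positive semidefinite $d\times d$ matrices with $\sum_x M_x=\mathbb I_d$; measuring $\rho$ with $\mathcal M$ gives outcome $x$ with probability $\operatorname{Tr}[\rho M_x]$. Its measurement information channel is the linear map $$\mathcal H_{\mathcal M}(A)=\sum_x M_x\,\frac{\operatorname{Tr}[M_xA]}{\operatorname{Tr}[M_x]},\qquad A\in\mathbb C^{d\times d}$$ (terms with $M_x=0$ are omitted). For a linear operator on $\mathbb C^d$, or on $\mathbb C^{d\times d}$ with the Hilbert–Schmidt inner product, $\|\cdot\|_1$ and $\|\cdot\|_{\mathrm{HS}}$ denote the $\ell_1$ and $\ell_2$ norms of its singular values. Let $\mathfrak M$ be a set of POVMs on $\mathbb C^d$ and $\varepsilon>0$. A *fixed* scheme with $n$ copies consists of $\mathcal M_1,\dots,\mathcal M_n\in\mathfrak M$ and a (possibly randomized) tester which sees the outcomes $x_1,\dots,x_n$ of measuring the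 $i$-th copy of $\rho$ with $\mathcal M_i$ (the outcomes are independent) and answers YES or NO. In a *randomized non-adaptive* scheme, $\mathcal M_1,\dots,\mathcal M_n\in\mathfrak M$ are functions of a random seed $R$ independent of the copies; conditioned on $R$ the outcomes are independent as above, and the tester may also use $R$. A scheme solves mixedness testing if it answers YES with probability at least $2/3$ when $\rho=\rho_{\mathrm{mm}}$, and NO with probability at least $2/3$ for every state $\rho$ with $\|\rho-\rho_{\mathrm{mm}}\|_1>\varepsilon$. Let $n_F$ (respectively $n_R$) be the least $n$ for which some fixed (respectively randomized non-adaptive) scheme with $n$ copies solves mixedness testing, and $\infty$ if there is none. **Theorem.** There is an absolute constant $c>0$ such that for all $d\ge 16$, all $0<\varepsilon\le 1/200$ and every set $\mathfrak M$ of POVMs on $\mathbb C^d$, $$n_R\ \ge\ c\,\frac{d^2}{\varepsilon^2\,\sup_{\mathcal M\in\mathfrak M}\|\mathcal H_{\mathcal M}\|_{\mathrm{HS}}},\qquad n_F\ \ge\ c\,\frac{d^2}{\varepsilon^2}\cdot\frac{d}{\sup_{\mathcal M\in\mathfrak M}\|\mathcal H_{\mathcal M}\|_1}.$$ -/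

import Mathlib

open MeasureTheory
open scoped ENNReal ComplexOrder

namespace MixTest

section Schatten

variable {ι : Type*} [Fintype ι] [DecidableEq ι]

/-- The singular values of a square complex matrix: square roots of the eigenvalues of `Aᴴ A`. -/
noncomputable def singularValue (A : Matrix ι ι ℂ) (i : ι) : ℝ :=
  √((Matrix.isHermitian_conjTranspose_mul_self A).eigenvalues i)

/-- The trace norm (Schatten `1`-norm). -/
noncomputable def traceNorm (A : Matrix ι ι ℂ) : ℝ := ∑ i, singularValue A i

/-- The Hilbert-Schmidt norm (Schatten `2`-norm). -/
noncomputable def hsNorm (A : Matrix ι ι ℂ) : ℝ := √(∑ i, singularValue A i ^ 2)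

end Schatten

section Quantum

variable {d : ℕ}

/-- A state of a `d`-dimensional quantum system. -/
structure QState (d : ℕ) where
  mat : Matrix (Fin d) (Fin d) ℂ
  posSemidef : mat.PosSemidef
  trace_eq_one : mat.trace = 1

/-- The maximally mixed state `I / d`. -/
noncomputable def maximallyMixed (d : ℕ) [NeZero d] : QState d where
  mat := (d : ℂ)⁻¹ • 1
  posSemidef := Matrix.PosSemidef.one.smul (by positivity)
  trace_eq_one := by
    have h : (d : ℂ) ≠ 0 := Nat.cast_ne_zero.2 (NeZero.ne d)
    simp [Matrix.trace_smul, h]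

/-- A POVM with countably many outcomes, labelled by natural numbers. A measurement with finitely
many outcomes is the case where all but finitely many effects vanish (an outcome whose effect
vanishes never occurs). -/
structure POVM (d : ℕ) where
  effect : ℕ → Matrix (Fin d) (Fin d) ℂ
  posSemidef : ∀ x, (effect x).PosSemidef
  hasSum : HasSum effect 1

theorem trace_mul_nonneg {A B : Matrix (Fin d) (Fin d) ℂ} (hA : A.PosSemidef)
    (hB : B.PosSemidef) : 0 ≤ (A * B).trace := by
  open scoped MatrixOrder in
  obtain ⟨C, rfl⟩ := CStarAlgebra.nonneg_iff_eq_star_mul_self.1 hB.nonneg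
  rw [Matrix.star_eq_conjTranspose, ← Matrix.mul_assoc, Matrix.trace_mul_comm,
    ← Matrix.mul_assoc]
  exact (hA.mul_mul_conjTranspose_same C).trace_nonneg

theorem norm_entry_le_trace {A : Matrix (Fin d) (Fin d) ℂ} (hA : A.PosSemidef) (a b : Fin d) :
    ‖A a b‖ ≤ ‖A.trace‖ := by
  have hdiag : ∀ i, A i i = ((A i i).re : ℂ) := fun i =>
    Complex.ext rfl (by simpa using (Complex.le_def.1 (hA.diag_nonneg (i := i))).2.symm)
  have hnn : ∀ i, 0 ≤ (A i i).re := fun i =>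
    (Complex.le_def.1 (hA.diag_nonneg (i := i))).1
  have htr : ‖A.trace‖ = ∑ i, (A i i).re := by
    have : A.trace = ((∑ i, (A i i).re : ℝ) : ℂ) := by
      rw [Matrix.trace, Complex.ofReal_sum]
      exact Finset.sum_congr rfl fun i _ => hdiag i
    rw [this, Complex.norm_real, Real.norm_eq_abs,
      abs_of_nonneg (Finset.sum_nonneg fun i _ => hnn i)]
  have hle : ∀ i, (A i i).re ≤ ‖A.trace‖ := fun i => by
    rw [htr]
    exact Finset.single_le_sum (f := fun i => (A i i).re) (fun j _ => hnn j) (Finset.mem_univ i)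
  have hdet := (hA.submatrix ![a, b]).det_nonneg
  rw [Matrix.det_fin_two] at hdet
  simp only [Matrix.submatrix_apply, Matrix.cons_val_zero, Matrix.cons_val_one] at hdet
  rw [← hA.isHermitian.apply b a, hdiag a, hdiag b, Complex.star_def, Complex.mul_conj,
    ← Complex.ofReal_mul, ← Complex.ofReal_sub, Complex.zero_le_real,
    Complex.normSq_eq_norm_sq] at hdet
  have h1 := hle a
  have h2 := hle b
  have h3 := hnn a
  have h4 := hnn b
  refine abs_le_of_sq_le_sq' ?_ (norm_nonneg _) |>.2
  nlinarith [mul_le_mul h1 h2 h4 (norm_nonneg _)]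

theorem POVM.hasSum_trace_mul (M : POVM d) (A : Matrix (Fin d) (Fin d) ℂ) :
    HasSum (fun x => (A * M.effect x).trace) A.trace := by
  have h : Continuous fun B : Matrix (Fin d) (Fin d) ℂ => (A * B).trace := by fun_prop
  have := M.hasSum.map ((Matrix.traceLinearMap (Fin d) ℂ ℂ).comp
    (LinearMap.mulLeft ℂ A)) h
  simpa [Function.comp_def] using this

/-- Born's rule: the outcome distribution of the measurement `M` on the state `ρ`; the outcome
`x` has probability `Tr (ρ M_x)`. -/
noncomputable def POVM.law (M : POVM d) (ρ : QState d) : PMF ℕ :=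
  ⟨fun x => ENNReal.ofReal (ρ.mat * M.effect x).trace.re, by
    have h := Complex.hasSum_re (M.hasSum_trace_mul ρ.mat)
    rw [ρ.trace_eq_one, Complex.one_re] at h
    have hn : ∀ x, 0 ≤ (ρ.mat * M.effect x).trace.re := fun x =>
      (Complex.le_def.1 (trace_mul_nonneg ρ.posSemidef (M.posSemidef x))).1
    have := ENNReal.ofReal_tsum_of_nonneg hn h.summable
    rw [h.tsum_eq, ENNReal.ofReal_one] at this
    rw [this]
    exact ENNReal.summable.hasSum⟩

theorem POVM.summable_channel (M : POVM d) (A : Matrix (Fin d) (Fin d) ℂ) :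
    Summable fun x =>
      ((M.effect x * A).trace / (M.effect x).trace) • M.effect x := by
  refine Pi.summable.2 fun a => Pi.summable.2 fun b => ?_
  have hs : Summable fun x => ‖(M.effect x * A).trace‖ := by
    have := (M.hasSum_trace_mul A).summable.norm
    simpa only [Matrix.trace_mul_comm A] using this
  refine Summable.of_norm_bounded hs fun x => ?_
  simp only [Matrix.smul_apply, smul_eq_mul, norm_mul, norm_div]
  rcases eq_or_ne ‖(M.effect x).trace‖ 0 with h | h
  · rw [h]; simp
  · rw [div_mul_eq_mul_div, div_le_iff₀ (lt_of_le_of_ne (norm_nonneg _) (Ne.symm h))]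
    exact mul_le_mul_of_nonneg_left (norm_entry_le_trace (M.posSemidef x) a b) (norm_nonneg _)

/-- The measurement information channel `A ↦ ∑ₓ Mₓ Tr[Mₓ A] / Tr[Mₓ]`. Vanishing effects
contribute `0`. -/
noncomputable def POVM.channel (M : POVM d) :
    Matrix (Fin d) (Fin d) ℂ →ₗ[ℂ] Matrix (Fin d) (Fin d) ℂ where
  toFun A := ∑' x, ((M.effect x * A).trace / (M.effect x).trace) • M.effect x
  map_add' A B := by
    rw [← (M.summable_channel A).tsum_add (M.summable_channel B)]
    exact tsum_congr fun x => by
      rw [Matrix.mul_add, Matrix.trace_add, add_div, add_smul]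
  map_smul' r A := by
    rw [RingHom.id_apply, ← (M.summable_channel A).tsum_const_smul r]
    exact tsum_congr fun x => by
      rw [Matrix.mul_smul, Matrix.trace_smul, smul_eq_mul, mul_div_assoc, mul_smul]

/-- The matrix of a superoperator in the standard basis of matrix units, which is orthonormal for
the Hilbert-Schmidt inner product. The Schatten norms of a superoperator are those of this
matrix. -/
noncomputable def superMatrix
    (N : Matrix (Fin d) (Fin d) ℂ →ₗ[ℂ] Matrix (Fin d) (Fin d) ℂ) :
    Matrix (Fin d × Fin d) (Fin d × Fin d) ℂ :=
  LinearMap.toMatrix (Matrix.stdBasis ℂ (Fin d) (Fin d)) (Matrix.stdBasis ℂ (Fin d) (Fin d)) N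

/-- The Hilbert-Schmidt norm of the measurement information channel. -/
noncomputable def POVM.channelHsNorm (M : POVM d) : ℝ := hsNorm (superMatrix M.channel)

/-- The trace norm of the measurement information channel. -/
noncomputable def POVM.channelTraceNorm (M : POVM d) : ℝ := traceNorm (superMatrix M.channel)

/-- The joint distribution of the outcomes when the `i`-th of `n` copies of `ρ` is measured
with `M i`. -/
noncomputable def outcomeLaw {n : ℕ} (M : Fin n → POVM d) (ρ : QState d) :
    Measure (Fin n → ℕ) :=
  Measure.pi fun i => ((M i).law ρ).toMeasure

/-- `n` copies suffice for mixedness testing to accuracy `ε` with fixed measurements from `𝔐`.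
The (possibly randomized) tester `T` answers YES with probability `T x` on the outcomes `x`. -/
def FixedTestable [NeZero d] (𝔐 : Set (POVM d)) (ε : ℝ) (n : ℕ) : Prop :=
  ∃ (M : Fin n → POVM d) (T : (Fin n → ℕ) → unitInterval),
    (∀ i, M i ∈ 𝔐) ∧
    2 / 3 ≤ ∫ x, (T x : ℝ) ∂outcomeLaw M (maximallyMixed d) ∧
    ∀ ρ : QState d, ε < traceNorm (ρ.mat - (maximallyMixed d).mat) →
      2 / 3 ≤ ∫ x, (1 - (T x : ℝ)) ∂outcomeLaw M ρ

/-- `n` copies suffice for mixedness testing to accuracy `ε` with randomized non-adaptive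
measurements from `𝔐`: a random seed `ω` with law `P` determines the `n` measurements `M ω`, and
the tester, which may also use the seed, answers YES with probability `T ω x` on the
outcomes `x`. -/
def RandomizedTestable [NeZero d] (𝔐 : Set (POVM d)) (ε : ℝ) (n : ℕ) : Prop :=
  ∃ (Ω : Type) (_ : MeasurableSpace Ω) (P : Measure Ω) (_ : IsProbabilityMeasure P)
    (M : Ω → Fin n → POVM d) (T : Ω → (Fin n → ℕ) → unitInterval),
    (∀ ω i, M ω i ∈ 𝔐) ∧
    (∀ i x a b, Measurable fun ω => (M ω i).effect x a b) ∧
    (∀ x, Measurable fun ω => T ω x) ∧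
    2 / 3 ≤ ∫ ω, ∫ x, (T ω x : ℝ) ∂outcomeLaw (M ω) (maximallyMixed d) ∂P ∧
    ∀ ρ : QState d, ε < traceNorm (ρ.mat - (maximallyMixed d).mat) →
      2 / 3 ≤ ∫ ω, ∫ x, (1 - (T ω x : ℝ)) ∂outcomeLaw (M ω) ρ ∂P

/-- The copy complexity of mixedness testing with fixed measurements from `𝔐`: the least number
of copies that suffices (`⊤` if there is none). -/
noncomputable def fixedCopyComplexity [NeZero d] (𝔐 : Set (POVM d)) (ε : ℝ) : ℕ∞ :=
  ⨅ (n : ℕ) (_ : FixedTestable 𝔐 ε n), (n : ℕ∞)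

/-- The copy complexity of mixedness testing with randomized non-adaptive measurements
from `𝔐`: the least number of copies that suffices (`⊤` if there is none). -/
noncomputable def randomizedCopyComplexity [NeZero d] (𝔐 : Set (POVM d)) (ε : ℝ) : ℕ∞ :=
  ⨅ (n : ℕ) (_ : RandomizedTestable 𝔐 ε n), (n : ℕ∞)

end Quantum

end MixTest

/-! The argument is Le Cam's method against a random mixture. Perturb $\mathbb I/d$ by $cW_z$, where
$W_z=\sum_j z_ju_j$ is a random signed sum of $\kappa\ge d^2/3$ orthonormal traceless Hermitian
matrices and $c=20\varepsilon/d^{3/2}$. A net argument shows $\|W_z\|_{op}\le 6\sqrt d$ for 99% of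
the signs (`exists_good_signs`). For such signs $\mathbb I/d+cW_z$ is a state, and Hölder's bound
$\|W\|_1\ge\|W\|_{HS}^2/\|W\|_{op}$ puts it at trace distance above $\varepsilon$
(`exists_far_state`).

The second moment of the mixture's likelihood ratio averages products over copies of
$1+d\,\langle\delta,\mathcal H_i\delta'\rangle$. Each factor is at most the exponential of its
second summand, which leaves the exponential moment of a decoupled Rademacher chaos with matrix
$A_{jk}=\frac{400\varepsilon^2}{d^2}\sum_i\langle u_j,\mathcal H_iu_k\rangle$. By `sum_exp_chaos_le`
it stays near 1 as soon as $\|A\|_{HS}\le 1/10$, and then no tester succeeds (`exists_hard_family`).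

The two bounds differ in who chooses first. Against a random seed the $u_j$ must be chosen in
advance, and $\|A\|_{HS}$ is controlled by $n\sup\|\mathcal H\|_{HS}$. Fixed measurements are known
to the adversary, who takes the $u_j$ to be eigenvectors of the compressed $\sum_i\mathcal H_i$ with
small eigenvalues. By Markov's inequality on the trace there are enough of these, so the trace norm
governs. -/

namespace MixTest

/-! ### Exponential moments and tails of Rademacher sums and chaoses -/

section Rademacher

variable {κ : Type*} [Fintype κ] [DecidableEq κ]

/-- The sign `±1` encoded by a Boolean. -/
def boolSign (b : Bool) : ℝ := if b then 1 else -1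

theorem boolSign_mul_self (b : Bool) : boolSign b * boolSign b = 1 := by
  cases b <;> simp [boolSign]

/-- Rademacher sums are sub-Gaussian. -/
theorem sum_exp_rademacher_le (a : κ → ℝ) :
    ∑ z : κ → Bool, Real.exp (∑ j, a j * boolSign (z j)) ≤
      2 ^ Fintype.card κ * Real.exp ((∑ j, a j ^ 2) / 2) := by
  have h : ∑ z : κ → Bool, Real.exp (∑ j, a j * boolSign (z j)) =
      ∏ j, (2 * Real.cosh (a j)) := by
    have := Fintype.prod_sum (fun (j : κ) (b : Bool) => Real.exp (a j * boolSign b))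
    simp_rw [Real.exp_sum]
    rw [← this]
    refine Finset.prod_congr rfl fun j _ => ?_
    rw [Fintype.sum_bool, Real.cosh_eq]
    simp only [boolSign]
    norm_num
    ring
  rw [h, Finset.prod_mul_distrib, Finset.prod_const, Finset.card_univ, Finset.sum_div,
    Real.exp_sum]
  gcongr with j
  exact Real.cosh_le_exp_half_sq _

theorem integrable_exp_neg_sub_sq (c : ℝ) : Integrable fun x : ℝ => Real.exp (-(x - c) ^ 2) := by
  have := (integrable_exp_neg_mul_sq (b := 1) one_pos).comp_sub_right c
  simpa using this

theorem integral_exp_neg_sub_sq (c : ℝ) :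
    ∫ x : ℝ, Real.exp (-(x - c) ^ 2) = √Real.pi := by
  have := integral_sub_right_eq_self (μ := volume) (fun x : ℝ => Real.exp (-x ^ 2)) c
  rw [this]
  simpa using integral_gaussian 1

/-- Exponential moments of the square of a Rademacher sum. -/
theorem sum_exp_sq_rademacher_le (a : κ → ℝ) {t N : ℝ} (ht : 0 ≤ t)
    (hN : 2 * t * ∑ j, a j ^ 2 ≤ N) (hN1 : N < 1) :
    ∑ z : κ → Bool, Real.exp (t * (∑ j, a j * boolSign (z j)) ^ 2) ≤
      2 ^ Fintype.card κ * (√(1 - N))⁻¹ := by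
  have hpi : 0 < √Real.pi := Real.sqrt_pos.2 Real.pi_pos
  set s : (κ → Bool) → ℝ := fun z => ∑ j, a j * boolSign (z j) with hs
  -- Gaussian linearisation: completing the square writes $e^{ts^2}$ as the average of $e^{2\sqrt
  -- t\,xs}$ against $e^{-x^2}/\sqrt\pi$. The exponent is then linear in the signs and the
  -- sub-Gaussian bound applies for each $x$.
  have key : ∀ z, ∀ x : ℝ, Real.exp (t * s z ^ 2) * Real.exp (-(x - √t * s z) ^ 2) =
      Real.exp (-x ^ 2) * Real.exp (∑ j, (2 * √t * x * a j) * boolSign (z j)) := by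
    intro z x
    rw [← Real.exp_add, ← Real.exp_add]
    congr 1
    have : ∑ j, (2 * √t * x * a j) * boolSign (z j) = 2 * √t * x * s z := by
      rw [hs, Finset.mul_sum]
      exact Finset.sum_congr rfl fun j _ => by ring
    rw [this]
    have ht2 := Real.sq_sqrt ht
    linear_combination (s z ^ 2) * (-ht2)
  have hint : ∀ z, Integrable fun x : ℝ =>
      Real.exp (t * s z ^ 2) * Real.exp (-(x - √t * s z) ^ 2) := fun z =>
    (integrable_exp_neg_sub_sq _).const_mul _
  have h1 : √Real.pi * ∑ z, Real.exp (t * s z ^ 2) =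
      ∫ x : ℝ, ∑ z, Real.exp (t * s z ^ 2) * Real.exp (-(x - √t * s z) ^ 2) := by
    rw [integral_finsetSum _ fun z _ => hint z, Finset.mul_sum]
    refine Finset.sum_congr rfl fun z _ => ?_
    rw [integral_const_mul, integral_exp_neg_sub_sq, mul_comm]
  have h2 : ∫ x : ℝ, ∑ z, Real.exp (t * s z ^ 2) * Real.exp (-(x - √t * s z) ^ 2) ≤
      ∫ x : ℝ, 2 ^ Fintype.card κ * Real.exp (-(1 - N) * x ^ 2) := by
    refine integral_mono (integrable_finsetSum _ fun z _ => hint z)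
      ((integrable_exp_neg_mul_sq (by linarith)).const_mul _) fun x => ?_
    simp only [key, ← Finset.mul_sum]
    calc _ ≤ Real.exp (-x ^ 2) * (2 ^ Fintype.card κ *
          Real.exp ((∑ j, (2 * √t * x * a j) ^ 2) / 2)) := by
          gcongr
          exact sum_exp_rademacher_le _
      _ = 2 ^ Fintype.card κ * Real.exp (-x ^ 2 + (∑ j, (2 * √t * x * a j) ^ 2) / 2) := by
          rw [Real.exp_add]; ring
      _ ≤ _ := by
          gcongr
          have : ∑ j, (2 * √t * x * a j) ^ 2 = 2 * (2 * t * ∑ j, a j ^ 2) * x ^ 2 := by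
            rw [Finset.mul_sum, Finset.mul_sum, Finset.sum_mul]
            refine Finset.sum_congr rfl fun j _ => ?_
            linear_combination (4 * x ^ 2 * a j ^ 2) * Real.sq_sqrt ht
          rw [this]
          nlinarith [mul_le_mul_of_nonneg_right hN (sq_nonneg x)]
  rw [integral_const_mul, integral_gaussian, Real.sqrt_div Real.pi_pos.le] at h2
  rw [← h1] at h2
  refine le_of_mul_le_mul_left (h2.trans (le_of_eq ?_)) hpi
  ring

/-- Exponential moments of a decoupled Rademacher chaos of order two. -/
theorem sum_exp_chaos_le (A : κ → κ → ℝ) {N : ℝ}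
    (hN : ∑ k, ∑ j, A j k ^ 2 ≤ N) (hN1 : N < 1) :
    ∑ z : κ → Bool, ∑ z' : κ → Bool,
        Real.exp (∑ k, (∑ j, A j k * boolSign (z j)) * boolSign (z' k)) ≤
      (2 ^ Fintype.card κ) ^ 2 * (√(1 - N))⁻¹ := by
  set q : κ → ℝ := fun k => ∑ j, A j k ^ 2 with hq
  have hq0 : ∀ k, 0 ≤ q k := fun k => Finset.sum_nonneg fun j _ => sq_nonneg _
  set S := ∑ k, q k with hS
  set s : (κ → Bool) → κ → ℝ := fun z k => ∑ j, A j k * boolSign (z j) with hs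
  have hs0 : ∀ k, q k = 0 → ∀ z, s z k = 0 := by
    intro k hk z
    have := (Finset.sum_eq_zero_iff_of_nonneg fun j _ => sq_nonneg (A j k)).1 hk
    refine Finset.sum_eq_zero fun j hj => ?_
    rw [pow_eq_zero_iff two_ne_zero |>.1 (this j hj), zero_mul]
  have hSnn : 0 ≤ S := Finset.sum_nonneg fun k _ => hq0 k
  have hpos : 0 < 1 - N := by linarith
  have hinv : 1 ≤ (√(1 - N))⁻¹ := by
    rw [one_le_inv₀ (Real.sqrt_pos.2 hpos), Real.sqrt_le_left (by norm_num)]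
    linarith
  -- Averaging over `z'` alone leaves $\exp(\frac12\sum_k s_k^2)$, a product of dependent factors.
  have step : ∑ z : κ → Bool, Real.exp ((∑ k, s z k ^ 2) / 2) ≤
      2 ^ Fintype.card κ * (√(1 - N))⁻¹ := by
    rcases hSnn.eq_or_lt with h0 | h0
    · have hz : ∀ k, q k = 0 := fun k =>
        (Finset.sum_eq_zero_iff_of_nonneg fun k _ => hq0 k).1 h0.symm k (Finset.mem_univ k)
      have : ∀ z, ∑ k, s z k ^ 2 = 0 := fun z =>
        Finset.sum_eq_zero fun k _ => by rw [hs0 k (hz k) z]; ring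
      simp only [this]
      simpa using hinv
    · have hw : ∑ k, q k / S = 1 := by
        rw [← Finset.sum_div, ← hS, div_self h0.ne']
      -- Jensen with weights $q_k/S$ separates the dependent squares. The coefficient $S/(2q_k)$
      -- gives every square the same normalised parameter $2tq_k=S\le N$, so no factor depends on
      -- the number of terms.
      have hj : ∀ z, Real.exp ((∑ k, s z k ^ 2) / 2) ≤
          ∑ k, q k / S * Real.exp (S / (2 * q k) * s z k ^ 2) := by
        intro z
        have := convexOn_exp.map_sum_le (t := Finset.univ) (w := fun k => q k / S)
          (p := fun k => S / (2 * q k) * s z k ^ 2) (fun k _ => div_nonneg (hq0 k) hSnn) hw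
          (fun _ _ => Set.mem_univ _)
        simp only [smul_eq_mul] at this
        refine le_trans (le_of_eq ?_) this
        congr 1
        rw [Finset.sum_div]
        refine Finset.sum_congr rfl fun k _ => ?_
        rcases eq_or_ne (q k) 0 with h | h
        · rw [hs0 k h z]; simp
        · field_simp
      calc _ ≤ ∑ z, ∑ k, q k / S * Real.exp (S / (2 * q k) * s z k ^ 2) :=
            Finset.sum_le_sum fun z _ => hj z
        _ = ∑ k, q k / S * ∑ z, Real.exp (S / (2 * q k) * s z k ^ 2) := by
            rw [Finset.sum_comm]
            exact Finset.sum_congr rfl fun k _ => (Finset.mul_sum _ _ _).symm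
        _ ≤ ∑ k, q k / S * (2 ^ Fintype.card κ * (√(1 - N))⁻¹) := by
            refine Finset.sum_le_sum fun k _ =>
              mul_le_mul_of_nonneg_left ?_ (div_nonneg (hq0 k) hSnn)
            · refine sum_exp_sq_rademacher_le _ (by have := hq0 k; positivity) ?_ hN1
              change 2 * (S / (2 * q k)) * q k ≤ N
              rcases eq_or_ne (q k) 0 with h | h
              · rw [h]; simp; exact hSnn.trans hN
              · have : 2 * (S / (2 * q k)) * q k = S := by field_simp
                rw [this]; exact hN
        _ = _ := by rw [← Finset.sum_mul, hw, one_mul]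
  calc _ ≤ ∑ z : κ → Bool, 2 ^ Fintype.card κ * Real.exp ((∑ k, s z k ^ 2) / 2) :=
        Finset.sum_le_sum fun z _ => sum_exp_rademacher_le _
    _ ≤ _ := by
        rw [← Finset.mul_sum, sq, mul_assoc]
        gcongr

/-- Two-sided tail bound for Rademacher sums, in counting form. -/
theorem card_rademacher_tail_le (a : κ → ℝ) (ha : ∑ j, a j ^ 2 ≤ 1) {t : ℝ} (ht : 0 ≤ t) :
    ((Finset.univ.filter fun z : κ → Bool =>
        t < |∑ j, a j * boolSign (z j)|).card : ℝ) ≤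
      2 * (2 ^ Fintype.card κ * Real.exp (-(t ^ 2 / 2))) := by
  have aux : ∀ b : κ → ℝ, ∑ j, b j ^ 2 ≤ 1 →
      ((Finset.univ.filter fun z : κ → Bool => t < ∑ j, b j * boolSign (z j)).card : ℝ) ≤
        2 ^ Fintype.card κ * Real.exp (-(t ^ 2 / 2)) := by
    intro b hb
    -- Chernoff's bound; for variance at most 1 the best exponential parameter is the threshold `t`
    -- itself.
    have h := sum_exp_rademacher_le fun j => t * b j
    have h1 : ((Finset.univ.filter fun z : κ → Bool =>
        t < ∑ j, b j * boolSign (z j)).card : ℝ) * Real.exp (t ^ 2) ≤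
        ∑ z : κ → Bool, Real.exp (∑ j, t * b j * boolSign (z j)) := by
      rw [← nsmul_eq_mul, ← Finset.sum_const]
      refine (Finset.sum_le_sum fun z hz => ?_).trans
        (Finset.sum_le_sum_of_subset_of_nonneg (Finset.filter_subset _ _)
          fun _ _ _ => (Real.exp_pos _).le)
      have hz' := (Finset.mem_filter.1 hz).2
      rw [Real.exp_le_exp]
      simp only [mul_assoc, ← Finset.mul_sum]
      nlinarith
    have h2 : ∑ j, (t * b j) ^ 2 ≤ t ^ 2 := by
      simp only [mul_pow, ← Finset.mul_sum]
      nlinarith [sq_nonneg t]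
    have h3 := h1.trans (h.trans (mul_le_mul_of_nonneg_left
      (Real.exp_le_exp.2 (div_le_div_of_nonneg_right h2 zero_le_two)) (by positivity)))
    have h4 : Real.exp (t ^ 2 / 2) = Real.exp (-(t ^ 2 / 2)) * Real.exp (t ^ 2) := by
      rw [← Real.exp_add]; congr 1; ring
    rw [h4, ← mul_assoc] at h3
    exact le_of_mul_le_mul_right h3 (Real.exp_pos _)
  have h1 := aux a ha
  have h2 := aux (fun j => -a j) (by simpa using ha)
  have hsub : (Finset.univ.filter fun z : κ → Bool => t < |∑ j, a j * boolSign (z j)|) ⊆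
      (Finset.univ.filter fun z : κ → Bool => t < ∑ j, a j * boolSign (z j)) ∪
      (Finset.univ.filter fun z : κ → Bool => t < ∑ j, -a j * boolSign (z j)) := by
    intro z hz
    simp only [Finset.mem_union, Finset.mem_filter, Finset.mem_univ, true_and, neg_mul,
      Finset.sum_neg_distrib] at hz ⊢
    exact lt_abs.1 hz
  have h3 : ((Finset.univ.filter fun z : κ → Bool =>
      t < |∑ j, a j * boolSign (z j)|).card : ℝ) ≤ _ :=
    Nat.cast_le.2 ((Finset.card_le_card hsub).trans (Finset.card_union_le _ _))
  push_cast at h3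
  linarith

end Rademacher


/-! ### A net of the complex sphere -/

section Net

/-- The unit sphere of `ℂ^d` has a `1/2`-net with at most `25^d` points. -/
theorem exists_half_net (d : ℕ) :
    ∃ N : Finset (EuclideanSpace ℂ (Fin d)), N.card ≤ 25 ^ d ∧ (∀ φ ∈ N, ‖φ‖ = 1) ∧
      ∀ v : EuclideanSpace ℂ (Fin d), ‖v‖ = 1 → ∃ φ ∈ N, ‖φ - v‖ ≤ 1 / 2 := by
  classical
  let P : Finset (EuclideanSpace ℂ (Fin d)) → Prop := fun s =>
    (∀ φ ∈ s, ‖φ‖ = 1) ∧ ∀ φ ∈ s, ∀ ψ ∈ s, φ ≠ ψ → 1 / 2 ≤ ‖φ - ψ‖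
  have hcard : ∀ s, P s → s.card ≤ 25 ^ d := by
    intro s hs
    have hinj : Function.Injective fun x : EuclideanSpace ℂ (Fin d) => (2 : ℝ) • x :=
      smul_right_injective _ two_ne_zero
    -- After doubling, the points are 1-separated in the ball of radius 2. At most $5^{2d}$ such
    -- points fit, $2d$ being the real dimension.
    have h := Besicovitch.card_le_of_separated (s.image fun x => (2 : ℝ) • x)
      (by
        intro c hc
        obtain ⟨x, hx, rfl⟩ := Finset.mem_image.1 hc
        simp [norm_smul, hs.1 x hx])
      (by
        intro c hc e he hce
        obtain ⟨x, hx, rfl⟩ := Finset.mem_image.1 hc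
        obtain ⟨y, hy, rfl⟩ := Finset.mem_image.1 he
        have hxy : x ≠ y := fun h => hce (by rw [h])
        have := hs.2 x hx y hy hxy
        rw [← smul_sub, norm_smul, Real.norm_of_nonneg zero_le_two]
        linarith)
    rw [Finset.card_image_of_injective _ hinj, finrank_real_of_complex, finrank_euclideanSpace,
      Fintype.card_fin, pow_mul] at h
    norm_num at h
    exact h
  have hex : ∃ s, P s ∧ ∀ s', P s' → s'.card ≤ s.card := by
    have hbdd : BddAbove {k | ∃ s, P s ∧ s.card = k} :=
      ⟨25 ^ d, by rintro k ⟨s, hs, rfl⟩; exact hcard s hs⟩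
    have hne : {k | ∃ s, P s ∧ s.card = k}.Nonempty :=
      ⟨0, ∅, ⟨by simp, by simp⟩, rfl⟩
    obtain ⟨s, hs, hsk⟩ := Nat.sSup_mem hne hbdd
    exact ⟨s, hs, fun s' hs' => hsk ▸ le_csSup hbdd ⟨s', hs', rfl⟩⟩
  obtain ⟨s, hs, hmax⟩ := hex
  refine ⟨s, hcard s hs, hs.1, fun v hv => ?_⟩
  by_contra! hfar
  have hvs : v ∉ s := fun h => by
    have := hfar v h
    norm_num at this
  have hP : P (insert v s) := by
    refine ⟨fun φ hφ => ?_, fun φ hφ ψ hψ hne => ?_⟩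
    · rcases Finset.mem_insert.1 hφ with rfl | h
      exacts [hv, hs.1 φ h]
    · rcases Finset.mem_insert.1 hφ with rfl | h <;> rcases Finset.mem_insert.1 hψ with rfl | h'
      · exact absurd rfl hne
      · rw [norm_sub_rev]; exact (hfar ψ h').le
      · exact (hfar φ h).le
      · exact hs.2 φ h ψ h' hne
  have := hmax _ hP
  rw [Finset.card_insert_of_notMem hvs] at this
  omega

end Net

/-! ### Operator norm bounds and singular values of Hermitian matrices -/

section Spectral

open Matrix

variable {ι : Type*} [Fintype ι] [DecidableEq ι]

theorem posSemidef_smul_one_sub {X : Matrix ι ι ℂ} (hX : X.IsHermitian) {L : ℝ}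
    (h : ∀ i, hX.eigenvalues i ≤ L) : ((L : ℂ) • (1 : Matrix ι ι ℂ) - X).PosSemidef := by
  set U : Matrix ι ι ℂ := (hX.eigenvectorUnitary : Matrix ι ι ℂ) with hU
  have hUU : U * Uᴴ = 1 := Unitary.coe_mul_star_self hX.eigenvectorUnitary
  have hs : X = U * diagonal (fun i => (hX.eigenvalues i : ℂ)) * Uᴴ := by
    have := hX.spectral_theorem
    rwa [Unitary.conjStarAlgAut_apply] at this
  have : (L : ℂ) • (1 : Matrix ι ι ℂ) - X =
      U * diagonal (fun i => ((L - hX.eigenvalues i : ℝ) : ℂ)) * Uᴴ := by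
    have hd : diagonal (fun i => ((L - hX.eigenvalues i : ℝ) : ℂ)) =
        (L : ℂ) • (1 : Matrix ι ι ℂ) - diagonal (fun i => (hX.eigenvalues i : ℂ)) := by
      ext i j
      by_cases hij : i = j
      · subst hij; simp
      · simp [hij]
    rw [hd, Matrix.mul_sub, Matrix.sub_mul, Matrix.mul_smul, Matrix.smul_mul, Matrix.mul_one, hUU,
      ← hs]
  rw [this]
  refine PosSemidef.mul_mul_conjTranspose_same (PosSemidef.diagonal fun i => ?_) U
  simpa using h i

theorem posSemidef_smul_one_add {X : Matrix ι ι ℂ} (hX : X.IsHermitian) {L : ℝ}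
    (h : ∀ i, -L ≤ hX.eigenvalues i) : ((L : ℂ) • (1 : Matrix ι ι ℂ) + X).PosSemidef := by
  set U : Matrix ι ι ℂ := (hX.eigenvectorUnitary : Matrix ι ι ℂ) with hU
  have hUU : U * Uᴴ = 1 := Unitary.coe_mul_star_self hX.eigenvectorUnitary
  have hs : X = U * diagonal (fun i => (hX.eigenvalues i : ℂ)) * Uᴴ := by
    have := hX.spectral_theorem
    rwa [Unitary.conjStarAlgAut_apply] at this
  have : (L : ℂ) • (1 : Matrix ι ι ℂ) + X =
      U * diagonal (fun i => ((L + hX.eigenvalues i : ℝ) : ℂ)) * Uᴴ := by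
    have hd : diagonal (fun i => ((L + hX.eigenvalues i : ℝ) : ℂ)) =
        (L : ℂ) • (1 : Matrix ι ι ℂ) + diagonal (fun i => (hX.eigenvalues i : ℂ)) := by
      ext i j
      by_cases hij : i = j
      · subst hij; simp
      · simp [hij]
    rw [hd, Matrix.mul_add, Matrix.add_mul, Matrix.mul_smul, Matrix.smul_mul, Matrix.mul_one, hUU,
      ← hs]
  rw [this]
  refine PosSemidef.mul_mul_conjTranspose_same (PosSemidef.diagonal fun i => ?_) U
  have := h i
  simp only [Pi.zero_apply, Complex.zero_le_real]
  linarith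

theorem norm_sq_eq_re_dotProduct {κ : Type*} [Fintype κ] (x : EuclideanSpace ℂ κ) :
    ‖x‖ ^ 2 = (star x.ofLp ⬝ᵥ x.ofLp).re := by
  rw [EuclideanSpace.norm_sq_eq, dotProduct, Complex.re_sum]
  refine Finset.sum_congr rfl fun i _ => ?_
  rw [Pi.star_apply, Complex.star_def, Complex.conj_mul', ← Complex.ofReal_pow, Complex.ofReal_re]

/-- A bound for the quadratic form of a Hermitian matrix on a `1/2`-net of the unit sphere bounds
its operator norm. -/
theorem posSemidef_of_net {X : Matrix ι ι ℂ} (hX : X.IsHermitian)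
    {N : Finset (EuclideanSpace ℂ ι)} (hN1 : ∀ φ ∈ N, ‖φ‖ = 1)
    (hN : ∀ v : EuclideanSpace ℂ ι, ‖v‖ = 1 → ∃ φ ∈ N, ‖φ - v‖ ≤ 1 / 2) {t : ℝ}
    (ht : ∀ φ ∈ N, |(star φ.ofLp ⬝ᵥ X *ᵥ φ.ofLp).re| ≤ t) :
    (((2 * t : ℝ) : ℂ) • (1 : Matrix ι ι ℂ) - X).PosSemidef ∧
      (((2 * t : ℝ) : ℂ) • (1 : Matrix ι ι ℂ) + X).PosSemidef := by
  suffices h : ∀ i, |hX.eigenvalues i| ≤ 2 * t from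
    ⟨posSemidef_smul_one_sub hX fun i => (abs_le.1 (h i)).2,
      posSemidef_smul_one_add hX fun i => (abs_le.1 (h i)).1⟩
  intro i₀
  have : Nonempty ι := ⟨i₀⟩
  -- A net this coarse defeats the usual perturbation estimate. At a top eigenvector `v` the cross
  -- terms are exact: since `v` and `φ = v + e` are unit vectors, the form at `φ` is
  -- $\mu(1-\|e\|^2)+\langle e,Xe\rangle$, of modulus at least $|\mu|(1-2\|e\|^2)\ge|\mu|/2$.
  obtain ⟨i, hi⟩ := Finite.exists_max fun i => |hX.eigenvalues i|
  refine (hi i₀).trans ?_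
  set μ := hX.eigenvalues i with hμ
  have hP1 := posSemidef_smul_one_sub hX (L := |μ|) fun j => (abs_le.1 (hi j)).2
  have hP2 := posSemidef_smul_one_add hX (L := |μ|) fun j => (abs_le.1 (hi j)).1
  set v := hX.eigenvectorBasis i with hv
  have hv1 : ‖v‖ = 1 := hX.eigenvectorBasis.orthonormal.1 i
  obtain ⟨φ, hφ, hφv⟩ := hN v hv1
  set e := φ - v with he
  have hφe : φ = v + e := by rw [he]; abel
  have hXv : X *ᵥ v.ofLp = (μ : ℂ) • v.ofLp := by
    have := hX.mulVec_eigenvectorBasis i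
    rw [this]
    ext j
    simp [hμ, hv]
  have nv := norm_sq_eq_re_dotProduct v
  have nφ := norm_sq_eq_re_dotProduct φ
  have ne := norm_sq_eq_re_dotProduct e
  rw [hv1] at nv
  rw [hN1 φ hφ, hφe, WithLp.ofLp_add, star_add, add_dotProduct, dotProduct_add, dotProduct_add,
    Complex.add_re, Complex.add_re, Complex.add_re] at nφ
  have hconj : (star v.ofLp ⬝ᵥ e.ofLp).re = (star e.ofLp ⬝ᵥ v.ofLp).re := by
    rw [star_dotProduct, Complex.star_def, Complex.conj_re]
  have q1 := (Complex.le_def.1 (hP1.dotProduct_mulVec_nonneg e.ofLp)).1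
  have q2 := (Complex.le_def.1 (hP2.dotProduct_mulVec_nonneg e.ofLp)).1
  rw [sub_mulVec, dotProduct_sub, smul_mulVec, one_mulVec, dotProduct_smul, smul_eq_mul,
    Complex.sub_re, Complex.re_ofReal_mul, ← ne, Complex.zero_re] at q1
  rw [add_mulVec, dotProduct_add, smul_mulVec, one_mulVec, dotProduct_smul, smul_eq_mul,
    Complex.add_re, Complex.re_ofReal_mul, ← ne, Complex.zero_re] at q2
  have hvXe : star v.ofLp ⬝ᵥ X *ᵥ e.ofLp = (μ : ℂ) * (star v.ofLp ⬝ᵥ e.ofLp) := by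
    have hvm : star v.ofLp ᵥ* X = star (X *ᵥ v.ofLp) := by rw [star_mulVec, hX.eq]
    rw [dotProduct_mulVec, hvm, hXv]
    simp
  have hφX := ht φ hφ
  have hexp : (star φ.ofLp ⬝ᵥ X *ᵥ φ.ofLp).re =
      μ * (1 + 2 * (star e.ofLp ⬝ᵥ v.ofLp).re) + (star e.ofLp ⬝ᵥ X *ᵥ e.ofLp).re := by
    rw [hφe, WithLp.ofLp_add, star_add, mulVec_add, add_dotProduct, dotProduct_add,
      dotProduct_add, hvXe, hXv, dotProduct_smul, dotProduct_smul, smul_eq_mul, smul_eq_mul]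
    simp only [Complex.add_re, Complex.re_ofReal_mul]
    rw [hconj, ← nv]
    ring
  rw [hexp] at hφX
  have he2 : ‖e‖ ^ 2 ≤ 1 / 4 := by nlinarith [norm_nonneg e]
  have ha : 2 * (star e.ofLp ⬝ᵥ v.ofLp).re = -‖e‖ ^ 2 := by
    rw [hconj, ← nv, ← ne] at nφ
    linarith
  rw [ha] at hφX
  have h3 : |μ| * (1 - ‖e‖ ^ 2) ≤ |μ * (1 + -‖e‖ ^ 2)| := by
    rw [abs_mul, abs_of_nonneg (a := 1 + -‖e‖ ^ 2) (by linarith)]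
    exact le_of_eq (by ring)
  have h4 : |(star e.ofLp ⬝ᵥ X *ᵥ e.ofLp).re| ≤ |μ| * ‖e‖ ^ 2 :=
    abs_le.2 ⟨by linarith, by linarith⟩
  have h5 := abs_sub_abs_le_abs_add (μ * (1 + -‖e‖ ^ 2)) (star e.ofLp ⬝ᵥ X *ᵥ e.ofLp).re
  nlinarith [abs_nonneg μ]

/-- If `-L ≤ X ≤ L`, then the singular values of `X` are at most `L`. -/
theorem singularValue_le {X : Matrix ι ι ℂ} (hX : X.IsHermitian) {L : ℝ} (hL : 0 < L)
    (h1 : ((L : ℂ) • (1 : Matrix ι ι ℂ) - X).PosSemidef)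
    (h2 : ((L : ℂ) • (1 : Matrix ι ι ℂ) + X).PosSemidef) (i : ι) : singularValue X i ≤ L := by
  -- As $L-X$ and $L+X$ commute, the right side is $(L^2-X^2)$ times their sum $2L$; it is also
  -- visibly a sum of two congruences of positive matrices.
  have hpos : ((2 * L : ℝ) : ℂ) • (((L ^ 2 : ℝ) : ℂ) • (1 : Matrix ι ι ℂ) - Xᴴ * X) =
      ((L : ℂ) • (1 : Matrix ι ι ℂ) - X) * ((L : ℂ) • (1 : Matrix ι ι ℂ) + X) *
          ((L : ℂ) • (1 : Matrix ι ι ℂ) - X)ᴴ +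
        ((L : ℂ) • (1 : Matrix ι ι ℂ) + X) * ((L : ℂ) • (1 : Matrix ι ι ℂ) - X) *
          ((L : ℂ) • (1 : Matrix ι ι ℂ) + X)ᴴ := by
    rw [h1.isHermitian.eq, h2.isHermitian.eq, hX.eq]
    simp only [Matrix.mul_add, Matrix.add_mul, Matrix.mul_sub, Matrix.sub_mul, Matrix.smul_mul,
      Matrix.mul_smul, Matrix.one_mul, Matrix.mul_one, smul_sub, smul_add, smul_smul]
    push_cast
    module
  have hps := (h2.mul_mul_conjTranspose_same ((L : ℂ) • (1 : Matrix ι ι ℂ) - X)).add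
    (h1.mul_mul_conjTranspose_same ((L : ℂ) • (1 : Matrix ι ι ℂ) + X))
  rw [← hpos] at hps
  set hH := isHermitian_conjTranspose_mul_self X
  have hq := hps.dotProduct_mulVec_nonneg (hH.eigenvectorBasis i).ofLp
  have hnv := norm_sq_eq_re_dotProduct (hH.eigenvectorBasis i)
  rw [hH.eigenvectorBasis.orthonormal.1 i] at hnv
  have hev := hH.eigenvalues_eq i
  have hq' := (Complex.le_def.1 hq).1
  rw [smul_mulVec, dotProduct_smul, smul_eq_mul, Complex.re_ofReal_mul, sub_mulVec,
    dotProduct_sub, smul_mulVec, one_mulVec, dotProduct_smul, smul_eq_mul,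
    Complex.sub_re, Complex.re_ofReal_mul, ← hnv, Complex.zero_re] at hq'
  rw [singularValue, Real.sqrt_le_left hL.le, hev]
  have h3 : 0 ≤ L ^ 2 * 1 ^ 2 - (star (hH.eigenvectorBasis i).ofLp ⬝ᵥ
      (Xᴴ * X) *ᵥ (hH.eigenvectorBasis i).ofLp).re :=
    nonneg_of_mul_nonneg_right hq' (by positivity)
  simpa using h3

theorem sum_singularValue_sq (X : Matrix ι ι ℂ) :
    ∑ i, singularValue X i ^ 2 = (Xᴴ * X).trace.re := by
  have h0 := (posSemidef_conjTranspose_mul_self X).eigenvalues_nonneg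
  rw [(isHermitian_conjTranspose_mul_self X).trace_eq_sum_eigenvalues, Complex.re_sum]
  refine Finset.sum_congr rfl fun i _ => ?_
  rw [singularValue, Real.sq_sqrt (h0 i)]
  simp

theorem sum_singularValue_sq_eq_sum_norm_sq (X : Matrix ι ι ℂ) :
    ∑ i, singularValue X i ^ 2 = ∑ i, ∑ j, ‖X i j‖ ^ 2 := by
  rw [sum_singularValue_sq, trace, Complex.re_sum, Finset.sum_comm]
  refine Finset.sum_congr rfl fun i _ => ?_
  rw [diag_apply, mul_apply, Complex.re_sum]
  refine Finset.sum_congr rfl fun j _ => ?_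
  rw [conjTranspose_apply, Complex.star_def, Complex.conj_mul', ← Complex.ofReal_pow,
    Complex.ofReal_re]

/-- Hölder's inequality between the trace norm, the operator norm and the Hilbert-Schmidt norm. -/
theorem trace_sq_le_mul_traceNorm {X : Matrix ι ι ℂ} (hX : X.IsHermitian) {L : ℝ} (hL : 0 < L)
    (h1 : ((L : ℂ) • (1 : Matrix ι ι ℂ) - X).PosSemidef)
    (h2 : ((L : ℂ) • (1 : Matrix ι ι ℂ) + X).PosSemidef) :
    (X * X).trace.re ≤ L * traceNorm X := by
  have := sum_singularValue_sq X
  rw [hX.eq] at this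
  rw [← this, traceNorm, Finset.mul_sum]
  refine Finset.sum_le_sum fun i _ => ?_
  rw [sq]
  exact mul_le_mul_of_nonneg_right (singularValue_le hX hL h1 h2 i) (Real.sqrt_nonneg _)

/-- Compute the trace in an eigenbasis $b_i$ of $A^*A$: there $\|Ab_i\|$ is the `i`-th singular
value, and Cauchy–Schwarz bounds each diagonal entry by it. -/
theorem re_trace_le_traceNorm (A : Matrix ι ι ℂ) : A.trace.re ≤ traceNorm A := by
  set hH := isHermitian_conjTranspose_mul_self A
  set b := hH.eigenvectorBasis
  have htr : A.trace = ∑ i, star (b i).ofLp ⬝ᵥ A *ᵥ (b i).ofLp := by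
    have h1 : A.trace = LinearMap.trace ℂ _ (A.toEuclideanLin) := by
      rw [toEuclideanLin_eq_toLin_orthonormal, trace_toLin_eq]
    rw [h1, LinearMap.trace_eq_sum_inner _ b]
    refine Finset.sum_congr rfl fun i _ => ?_
    rw [EuclideanSpace.inner_eq_star_dotProduct, dotProduct_comm]
    simp [toLpLin_apply]
  rw [htr, Complex.re_sum, traceNorm]
  refine Finset.sum_le_sum fun i _ => ?_
  set w : EuclideanSpace ℂ ι := WithLp.toLp 2 (A *ᵥ (b i).ofLp) with hw
  have hin : star (b i).ofLp ⬝ᵥ A *ᵥ (b i).ofLp = inner ℂ (b i) w := by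
    rw [EuclideanSpace.inner_eq_star_dotProduct, dotProduct_comm]
  have hnw : ‖w‖ ^ 2 = hH.eigenvalues i := by
    rw [norm_sq_eq_re_dotProduct, hH.eigenvalues_eq i, hw]
    rw [star_mulVec, dotProduct_mulVec, dotProduct_mulVec, vecMul_vecMul]
    rfl
  calc _ ≤ ‖inner ℂ (b i) w‖ := by rw [hin]; exact Complex.re_le_norm _
    _ ≤ ‖b i‖ * ‖w‖ := norm_inner_le_norm _ _
    _ = ‖w‖ := by rw [b.orthonormal.1 i, one_mul]
    _ = _ := by rw [singularValue, ← hnw, Real.sqrt_sq (norm_nonneg _)]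

end Spectral


/-! ### An orthonormal system of off-diagonal Hermitian matrices -/

section HermitianUnits

open Matrix

variable {d : ℕ}

/-- The cross term changes sign when `x` and `y` are exchanged, so it cancels in a sum over an array
and its transpose. -/
theorem norm_sq_rotate (x y : ℂ) :
    ‖(1 + Complex.I) / 2 * x + (1 - Complex.I) / 2 * y‖ ^ 2 =
      (‖x‖ ^ 2 + ‖y‖ ^ 2) / 2 + (x.re * y.im - x.im * y.re) := by
  have e : (1 + Complex.I) / 2 * x + (1 - Complex.I) / 2 * y =
      ⟨(x.re - x.im + y.re + y.im) / 2, (x.re + x.im + y.im - y.re) / 2⟩ := by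
    apply Complex.ext <;> simp <;> ring
  rw [e]
  simp only [← Complex.normSq_eq_norm_sq, Complex.normSq_apply]
  ring

theorem sum_swap {β : Type*} [AddCommMonoid β] (f : Fin d × Fin d → β) :
    ∑ p : Fin d × Fin d, f p.swap = ∑ p, f p :=
  Fintype.sum_equiv (Equiv.prodComm _ _) _ _ fun _ => rfl

/-- The map `f ↦ (1 + i)/2 f + (1 - i)/2 fᵀ` preserves the `ℓ²` norm of a square array. -/
theorem sum_norm_sq_rotate (f : Fin d × Fin d → ℂ) :
    ∑ p, ‖(1 + Complex.I) / 2 * f p + (1 - Complex.I) / 2 * f p.swap‖ ^ 2 = ∑ p, ‖f p‖ ^ 2 := by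
  simp only [norm_sq_rotate, Finset.sum_add_distrib, ← Finset.sum_div, Finset.sum_sub_distrib]
  rw [sum_swap fun p => ‖f p‖ ^ 2]
  have := sum_swap fun p : Fin d × Fin d => (f p).re * (f p.swap).im
  simp only [Prod.swap_swap] at this
  rw [← this]
  have h2 : ∑ p : Fin d × Fin d, (f p.swap).re * (f p).im =
      ∑ p : Fin d × Fin d, (f p).im * (f p.swap).re :=
    Finset.sum_congr rfl fun p _ => mul_comm _ _
  rw [h2]
  ring

/-- Hermitian combinations of matrix units; they form an orthonormal basis of the Hermitian
matrices. -/
noncomputable def hermUnit (p : Fin d × Fin d) : Matrix (Fin d) (Fin d) ℂ :=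
  ((1 + Complex.I) / 2) • single p.1 p.2 1 + ((1 - Complex.I) / 2) • single p.2 p.1 1

theorem conj_rotate : star ((1 + Complex.I) / 2 : ℂ) = (1 - Complex.I) / 2 := by
  apply Complex.ext <;> simp

theorem hermUnit_isHermitian (p : Fin d × Fin d) : (hermUnit p).IsHermitian := by
  have h2 : star ((1 - Complex.I) / 2 : ℂ) = (1 + Complex.I) / 2 := by
    rw [← conj_rotate, star_star]
  rw [IsHermitian, hermUnit, conjTranspose_add, conjTranspose_smul, conjTranspose_smul,
    conjTranspose_single, conjTranspose_single, star_one, conj_rotate, h2, add_comm]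

theorem trace_hermUnit_mul (p : Fin d × Fin d) (Y : Matrix (Fin d) (Fin d) ℂ) :
    (hermUnit p * Y).trace =
      (1 + Complex.I) / 2 * Y p.2 p.1 + (1 - Complex.I) / 2 * Y p.1 p.2 := by
  rw [hermUnit, Matrix.add_mul, trace_add, Matrix.smul_mul, Matrix.smul_mul, trace_smul,
    trace_smul, trace_single_mul, trace_single_mul]
  simp

/-- With $\alpha=(1+i)/2$ everything reduces to $2\alpha\bar\alpha=1$ (normalisation) and
$\alpha^2+\bar\alpha^2=0$ (orthogonality of the units at $(a,b)$ and $(b,a)$). -/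
theorem trace_hermUnit_mul_hermUnit {p q : Fin d × Fin d} (hp : p.1 ≠ p.2) :
    (hermUnit p * hermUnit q).trace = if p = q then 1 else 0 := by
  have h1 : ((1 + Complex.I) / 2 : ℂ) * ((1 + Complex.I) / 2) +
      (1 - Complex.I) / 2 * ((1 - Complex.I) / 2) = 0 := by
    linear_combination (1 / 2 : ℂ) * Complex.I_mul_I
  have h2 : ((1 + Complex.I) / 2 : ℂ) * ((1 - Complex.I) / 2) +
      (1 - Complex.I) / 2 * ((1 + Complex.I) / 2) = 1 := by
    linear_combination (-1 / 2 : ℂ) * Complex.I_mul_I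
  obtain ⟨a, b⟩ := p
  obtain ⟨c, e⟩ := q
  simp only at hp
  rw [trace_hermUnit_mul]
  simp only [hermUnit, Matrix.add_apply, Matrix.smul_apply, single_apply, smul_eq_mul,
    Prod.mk.injEq]
  by_cases hP : a = c ∧ b = e
  · obtain ⟨rfl, rfl⟩ := hP
    simp only [hp, hp.symm, and_self, if_true, if_false]
    linear_combination h2
  · rw [if_neg hP]
    have hP1 : ¬(c = a ∧ e = b) := fun h => hP ⟨h.1.symm, h.2.symm⟩
    have hP2 : ¬(e = b ∧ c = a) := fun h => hP1 h.symm
    rw [if_neg hP1, if_neg hP2]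
    by_cases hQ : c = b ∧ e = a
    · rw [if_pos hQ, if_pos hQ.symm]
      linear_combination h1
    · rw [if_neg hQ, if_neg fun h => hQ h.symm]
      simp

/-- The index set of the off-diagonal matrix entries. -/
abbrev OffDiag (d : ℕ) : Type := {p : Fin d × Fin d // p.1 ≠ p.2}

theorem card_offDiag (d : ℕ) : Fintype.card (OffDiag d) = d * d - d := by
  rw [Fintype.card_subtype]
  have := Finset.offDiag_card (s := (Finset.univ : Finset (Fin d)))
  rw [Finset.card_univ, Fintype.card_fin] at this
  rw [← this]
  congr 1
  ext p
  simp [Finset.mem_offDiag]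

theorem sum_offDiag_le (f : Fin d × Fin d → ℝ) (hf : ∀ p, 0 ≤ f p) :
    ∑ p : OffDiag d, f p ≤ ∑ p, f p := by
  rw [← Finset.sum_subtype (Finset.univ.filter fun p : Fin d × Fin d => p.1 ≠ p.2) (by simp) f]
  exact Finset.sum_le_sum_of_subset_of_nonneg (Finset.filter_subset _ _) fun p _ _ => hf p

/-- A real isometry from real vectors onto Hermitian matrices with vanishing diagonal. -/
noncomputable def hermOf : EuclideanSpace ℝ (OffDiag d) →ₗ[ℝ] Matrix (Fin d) (Fin d) ℂ where
  toFun v := ∑ p, (v p : ℂ) • hermUnit p.1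
  map_add' u v := by
    simp only [PiLp.add_apply, Complex.ofReal_add, add_smul, Finset.sum_add_distrib]
  map_smul' r v := by
    rw [Finset.smul_sum]
    refine Finset.sum_congr rfl fun p _ => ?_
    simp only [PiLp.smul_apply, smul_eq_mul, Complex.ofReal_mul, mul_smul, RingHom.id_apply]
    rfl

theorem hermOf_apply (v : EuclideanSpace ℝ (OffDiag d)) :
    hermOf v = ∑ p, (v p : ℂ) • hermUnit p.1 := rfl

theorem hermOf_isHermitian (v : EuclideanSpace ℝ (OffDiag d)) : (hermOf v).IsHermitian := by
  rw [IsHermitian, hermOf_apply, conjTranspose_sum]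
  refine Finset.sum_congr rfl fun p _ => ?_
  rw [conjTranspose_smul, (hermUnit_isHermitian _).eq, Complex.star_def, Complex.conj_ofReal]

theorem trace_hermOf (v : EuclideanSpace ℝ (OffDiag d)) : (hermOf v).trace = 0 := by
  rw [hermOf_apply, trace_sum]
  refine Finset.sum_eq_zero fun p _ => ?_
  have := trace_hermUnit_mul p.1 1
  rw [Matrix.mul_one, one_apply_ne p.2, one_apply_ne p.2.symm] at this
  rw [trace_smul, this]
  simp

theorem trace_hermOf_mul_hermOf (u v : EuclideanSpace ℝ (OffDiag d)) :
    (hermOf u * hermOf v).trace.re = inner ℝ u v := by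
  rw [hermOf_apply, hermOf_apply, Finset.sum_mul, trace_sum, PiLp.inner_apply, Complex.re_sum]
  refine Finset.sum_congr rfl fun p _ => ?_
  rw [Finset.mul_sum, trace_sum, Finset.sum_eq_single p]
  · rw [Matrix.smul_mul, Matrix.mul_smul, trace_smul, trace_smul,
      trace_hermUnit_mul_hermUnit p.2, if_pos rfl]
    simp [mul_comm]
  · intro q _ hq
    rw [Matrix.smul_mul, Matrix.mul_smul, trace_smul, trace_smul,
      trace_hermUnit_mul_hermUnit p.2, if_neg fun h => hq (Subtype.ext h.symm)]
    simp
  · simp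

/-- Bessel's inequality for the quadratic forms of an orthonormal family of Hermitian matrices at
a unit vector. -/
theorem sum_sq_quadForm_hermOf_le {κ : Type*} [Fintype κ]
    {u : κ → EuclideanSpace ℝ (OffDiag d)} (hu : Orthonormal ℝ u)
    {φ : EuclideanSpace ℂ (Fin d)} (hφ : ‖φ‖ = 1) :
    ∑ j, ((star φ.ofLp ⬝ᵥ hermOf (u j) *ᵥ φ.ofLp).re) ^ 2 ≤ 1 := by
  set f : Fin d × Fin d → ℂ := fun p => star (φ p.1) * φ p.2 with hf
  set g : Fin d × Fin d → ℂ := fun p =>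
    (1 + Complex.I) / 2 * f p + (1 - Complex.I) / 2 * f p.swap with hg
  have hsing : ∀ a b : Fin d, star φ.ofLp ⬝ᵥ (single a b (1 : ℂ)) *ᵥ φ.ofLp =
      star (φ a) * φ b := by
    intro a b
    rw [single_mulVec, ← Pi.single, dotProduct_single]
    simp
  have hquad : ∀ p, star φ.ofLp ⬝ᵥ hermUnit p *ᵥ φ.ofLp = g p := by
    intro p
    rw [hermUnit, add_mulVec, dotProduct_add, smul_mulVec, smul_mulVec, dotProduct_smul,
      dotProduct_smul, hsing, hsing]
    rfl
  set w : EuclideanSpace ℝ (OffDiag d) := WithLp.toLp 2 fun p => (g p.1).re with hw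
  have hin : ∀ j, (star φ.ofLp ⬝ᵥ hermOf (u j) *ᵥ φ.ofLp).re = inner ℝ (u j) w := by
    intro j
    rw [hermOf_apply, sum_mulVec, dotProduct_sum, Complex.re_sum, PiLp.inner_apply]
    refine Finset.sum_congr rfl fun p _ => ?_
    rw [smul_mulVec, dotProduct_smul, hquad, smul_eq_mul, Complex.re_ofReal_mul]
    simp [hw, mul_comm]
  -- The forms are the inner products of the `u j` with the coordinates `w` of the rank-one
  -- projection onto `φ`, whose Hilbert–Schmidt norm is 1.
  have hB := hu.sum_inner_products_le w (s := Finset.univ)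
  have hw1 : ‖w‖ ^ 2 ≤ 1 := by
    rw [EuclideanSpace.norm_sq_eq]
    calc ∑ p, ‖w p‖ ^ 2 ≤ ∑ p : OffDiag d, ‖g p.1‖ ^ 2 := by
          refine Finset.sum_le_sum fun p _ => ?_
          have : ‖w p‖ ≤ ‖g p.1‖ := Complex.abs_re_le_norm (g p.1)
          gcongr
      _ ≤ ∑ p, ‖g p‖ ^ 2 := sum_offDiag_le (fun p => ‖g p‖ ^ 2) fun p => sq_nonneg _
      _ = ∑ p, ‖f p‖ ^ 2 := sum_norm_sq_rotate f
      _ = (∑ a, ‖φ a‖ ^ 2) * ∑ b, ‖φ b‖ ^ 2 := by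
          rw [Finset.sum_mul_sum, Fintype.sum_prod_type]
          simp only [hf, norm_mul, norm_star, mul_pow]
      _ = 1 := by
          rw [← EuclideanSpace.norm_sq_eq, hφ]; norm_num
  refine le_trans (le_of_eq ?_) (hB.trans hw1)
  refine Finset.sum_congr rfl fun j _ => ?_
  rw [hin j, Real.norm_eq_abs, sq_abs]

end HermitianUnits

/-! ### The measurement information channel as a real bilinear form -/

section Channel

open Matrix

variable {d : ℕ}

/-- The real bilinear form `Re Tr[X 𝓗(Y)]` of the measurement information channel. -/
noncomputable def POVM.form (M : POVM d) (X Y : Matrix (Fin d) (Fin d) ℂ) : ℝ :=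
  (X * M.channel Y).trace.re

theorem im_trace_mul_eq_zero {X Y : Matrix (Fin d) (Fin d) ℂ} (hX : X.IsHermitian)
    (hY : Y.IsHermitian) : (X * Y).trace.im = 0 := by
  have h : star (X * Y).trace = (X * Y).trace := by
    rw [← trace_conjTranspose, conjTranspose_mul, hX.eq, hY.eq, trace_mul_comm]
  exact Complex.conj_eq_iff_im.1 h

/-- On Hermitian matrices all the traces are real, so the channel becomes a sum of rank-one real
forms. Symmetry, positivity and the link with likelihood ratios are read off from this series. -/
theorem POVM.hasSum_form (M : POVM d) {X Y : Matrix (Fin d) (Fin d) ℂ} (hX : X.IsHermitian)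
    (hY : Y.IsHermitian) :
    HasSum (fun x => (X * M.effect x).trace.re * (Y * M.effect x).trace.re /
      (M.effect x).trace.re) (M.form X Y) := by
  have h0 : HasSum (fun x => ((M.effect x * Y).trace / (M.effect x).trace) • M.effect x)
      (M.channel Y) := (M.summable_channel Y).hasSum
  have hc : Continuous fun B : Matrix (Fin d) (Fin d) ℂ => (X * B).trace := by fun_prop
  have h1 := h0.map ((traceLinearMap (Fin d) ℂ ℂ).comp (LinearMap.mulLeft ℂ X)) hc
  have h2 := Complex.hasSum_re h1
  change HasSum _ (M.form X Y) at h2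
  have hre : ∀ {c : ℂ}, c.im = 0 → c = (c.re : ℂ) := fun h => Complex.ext rfl (by simpa using h)
  convert h2 using 1
  funext x
  have hM := (M.posSemidef x).isHermitian
  have e1 := hre (im_trace_mul_eq_zero hX hM)
  have e2 := hre (im_trace_mul_eq_zero hY hM)
  have e3 := hre (im_trace_mul_eq_zero hM isHermitian_one)
  rw [Matrix.mul_one] at e3
  simp only [Function.comp_apply, LinearMap.comp_apply, LinearMap.mulLeft_apply,
    traceLinearMap_apply, Matrix.mul_smul, trace_smul, smul_eq_mul]
  rw [trace_mul_comm (M.effect x) Y, e1, e2, e3, ← Complex.ofReal_div, ← Complex.ofReal_mul]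
  simp only [Complex.ofReal_re]
  ring

theorem POVM.form_symm (M : POVM d) {X Y : Matrix (Fin d) (Fin d) ℂ} (hX : X.IsHermitian)
    (hY : Y.IsHermitian) : M.form X Y = M.form Y X := by
  refine (M.hasSum_form hX hY).unique ?_
  simpa only [mul_comm] using M.hasSum_form hY hX

theorem POVM.form_self_nonneg (M : POVM d) {X : Matrix (Fin d) (Fin d) ℂ} (hX : X.IsHermitian) :
    0 ≤ M.form X X := by
  refine (M.hasSum_form hX hX).nonneg fun x => div_nonneg (mul_self_nonneg _) ?_
  exact (Complex.le_def.1 (M.posSemidef x).trace_nonneg).1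

theorem superMatrix_apply (N : Matrix (Fin d) (Fin d) ℂ →ₗ[ℂ] Matrix (Fin d) (Fin d) ℂ)
    (p q : Fin d × Fin d) : superMatrix N p q = N (single q.1 q.2 1) p.1 p.2 := by
  rw [superMatrix, LinearMap.toMatrix_apply, stdBasis_eq_single]
  rfl

theorem trace_hermUnit_channel (N : Matrix (Fin d) (Fin d) ℂ →ₗ[ℂ] Matrix (Fin d) (Fin d) ℂ)
    (p q : Fin d × Fin d) :
    (hermUnit p * N (hermUnit q)).trace =
      (1 + Complex.I) / 2 * ((1 + Complex.I) / 2 * superMatrix N p.swap q +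
        (1 - Complex.I) / 2 * superMatrix N p.swap q.swap) +
      (1 - Complex.I) / 2 * ((1 + Complex.I) / 2 * superMatrix N p q +
        (1 - Complex.I) / 2 * superMatrix N p q.swap) := by
  rw [trace_hermUnit_mul]
  nth_rewrite 2 [hermUnit]
  nth_rewrite 1 [hermUnit]
  simp only [map_add, map_smul, Matrix.add_apply, Matrix.smul_apply, superMatrix_apply, smul_eq_mul,
    Prod.fst_swap, Prod.snd_swap]

/-- Replacing matrix units by Hermitian units rotates the rows and the columns of the channel's
matrix, each preserving the $\ell^2$ norm; taking real parts and dropping diagonal indices only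
lowers the sum. -/
theorem POVM.sum_form_sq_le (M : POVM d) :
    ∑ p : OffDiag d, ∑ q : OffDiag d, M.form (hermUnit p.1) (hermUnit q.1) ^ 2 ≤
      M.channelHsNorm ^ 2 := by
  set S := superMatrix M.channel with hS
  have hns : M.channelHsNorm ^ 2 = ∑ p, ∑ q, ‖S p q‖ ^ 2 := by
    rw [POVM.channelHsNorm, hsNorm, Real.sq_sqrt (Finset.sum_nonneg fun i _ => sq_nonneg _),
      sum_singularValue_sq_eq_sum_norm_sq]
  set r : Fin d × Fin d → Fin d × Fin d → ℂ := fun p q =>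
    (1 + Complex.I) / 2 * S p q + (1 - Complex.I) / 2 * S p q.swap with hr
  have hle : ∀ p q, M.form (hermUnit p) (hermUnit q) ^ 2 ≤
      ‖(1 + Complex.I) / 2 * r p.swap q + (1 - Complex.I) / 2 * r p.swap.swap q‖ ^ 2 := by
    intro p q
    rw [← sq_abs, Prod.swap_swap]
    have : |M.form (hermUnit p) (hermUnit q)| ≤
        ‖(1 + Complex.I) / 2 * r p.swap q + (1 - Complex.I) / 2 * r p q‖ := by
      rw [hr, ← trace_hermUnit_channel]
      exact Complex.abs_re_le_norm _
    gcongr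
  calc _ ≤ ∑ p : OffDiag d, ∑ q, M.form (hermUnit p.1) (hermUnit q) ^ 2 :=
        Finset.sum_le_sum fun p _ => sum_offDiag_le
          (fun q => M.form (hermUnit p.1) (hermUnit q) ^ 2) fun q => sq_nonneg _
    _ ≤ ∑ p, ∑ q, M.form (hermUnit p) (hermUnit q) ^ 2 := sum_offDiag_le
          (fun p => ∑ q, M.form (hermUnit p) (hermUnit q) ^ 2)
          fun p => Finset.sum_nonneg fun q _ => sq_nonneg _
    _ ≤ ∑ p : Fin d × Fin d, ∑ q,
          ‖(1 + Complex.I) / 2 * r p.swap q + (1 - Complex.I) / 2 * r p.swap.swap q‖ ^ 2 :=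
        Finset.sum_le_sum fun p _ => Finset.sum_le_sum fun q _ => hle p q
    _ = ∑ p, ∑ q, ‖r p q‖ ^ 2 := by
        rw [Finset.sum_comm, Finset.sum_comm (f := fun p q => ‖r p q‖ ^ 2)]
        refine Finset.sum_congr rfl fun q _ => ?_
        rw [sum_swap (f := fun p =>
          ‖(1 + Complex.I) / 2 * r p q + (1 - Complex.I) / 2 * r p.swap q‖ ^ 2)]
        exact sum_norm_sq_rotate fun p => r p q
    _ = _ := by
        rw [hns]
        exact Finset.sum_congr rfl fun p _ => sum_norm_sq_rotate fun q => S p q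

/-- The discarded diagonal terms are nonnegative, and the full sum is the real part of the channel's
trace, which is invariant under the change of basis. -/
theorem POVM.sum_form_self_le (M : POVM d) :
    ∑ p : OffDiag d, M.form (hermUnit p.1) (hermUnit p.1) ≤ M.channelTraceNorm := by
  set S := superMatrix M.channel with hS
  refine (sum_offDiag_le (fun p => M.form (hermUnit p) (hermUnit p)) fun p =>
    M.form_self_nonneg (hermUnit_isHermitian p)).trans ?_
  refine le_trans (le_of_eq ?_) (re_trace_le_traceNorm S)
  simp only [POVM.form]
  rw [← Complex.re_sum]
  congr 1
  simp only [trace_hermUnit_channel, ← hS]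
  have h1 := sum_swap fun p : Fin d × Fin d => S p.swap p
  have h2 := sum_swap fun p : Fin d × Fin d => S p p
  simp only [Prod.swap_swap] at h1
  simp only [Finset.sum_add_distrib, ← Finset.mul_sum]
  rw [h1, h2, trace]
  simp only [diag_apply]
  have hI := Complex.I_mul_I
  generalize ∑ p : Fin d × Fin d, S p.swap p = a
  generalize ∑ p : Fin d × Fin d, S p p = b
  linear_combination (a / 2 - b / 2) * hI

end Channel


/-! ### Likelihood ratios and Le Cam's method -/

section SecondMoment

open Matrix

variable {d n : ℕ}

/-- The probability of the outcome `x` when `ρ` is measured with `M`. -/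
noncomputable def POVM.prob (M : POVM d) (ρ : QState d) (x : ℕ) : ℝ := (ρ.mat * M.effect x).trace.re

theorem POVM.prob_nonneg (M : POVM d) (ρ : QState d) (x : ℕ) : 0 ≤ M.prob ρ x :=
  (Complex.le_def.1 (trace_mul_nonneg ρ.posSemidef (M.posSemidef x))).1

theorem POVM.law_apply (M : POVM d) (ρ : QState d) (x : ℕ) :
    (M.law ρ).toMeasure {x} = ENNReal.ofReal (M.prob ρ x) := by
  rw [PMF.toMeasure_apply_singleton _ _ (measurableSet_singleton x)]
  rfl

theorem POVM.hasSum_prob (M : POVM d) (ρ : QState d) : HasSum (M.prob ρ) 1 := by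
  have := Complex.hasSum_re (M.hasSum_trace_mul ρ.mat)
  rwa [ρ.trace_eq_one, Complex.one_re] at this

theorem POVM.integrable_of_bounded (M : POVM d) (ρ : QState d) (f : ℕ → ℝ) (C : ℝ)
    (hf : ∀ x, |f x| ≤ C) : Integrable f (M.law ρ).toMeasure :=
  Integrable.of_bound (measurable_of_countable f).aestronglyMeasurable C
    (Filter.Eventually.of_forall hf)

instance (M : Fin n → POVM d) (ρ : QState d) : IsProbabilityMeasure (outcomeLaw M ρ) := by
  unfold outcomeLaw
  infer_instance

theorem integrable_outcomeLaw_of_bounded (M : Fin n → POVM d) (ρ : QState d)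
    (f : (Fin n → ℕ) → ℝ) (C : ℝ) (hf : ∀ x, |f x| ≤ C) : Integrable f (outcomeLaw M ρ) :=
  Integrable.of_bound (measurable_of_countable f).aestronglyMeasurable C
    (Filter.Eventually.of_forall hf)

variable [NeZero d]

/-- The likelihood ratio of a state against the maximally mixed state. -/
noncomputable def POVM.ratio (M : POVM d) (ρ : QState d) (x : ℕ) : ℝ :=
  M.prob ρ x / M.prob (maximallyMixed d) x

theorem POVM.ratio_nonneg (M : POVM d) (ρ : QState d) (x : ℕ) : 0 ≤ M.ratio ρ x :=
  div_nonneg (M.prob_nonneg _ _) (M.prob_nonneg _ _)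

theorem POVM.prob_maximallyMixed (M : POVM d) (x : ℕ) :
    M.prob (maximallyMixed d) x = (M.effect x).trace.re / d := by
  rw [POVM.prob, maximallyMixed, Matrix.smul_mul, Matrix.one_mul, trace_smul, smul_eq_mul,
    ← Complex.ofReal_natCast, ← Complex.ofReal_inv, Complex.re_ofReal_mul]
  ring

/-- Domination by $2\rho_{\mathrm{mm}}$ gives absolute continuity, which makes division by zero in
`ratio` harmless, and bounds the ratios, which makes the integrals below converge. -/
theorem POVM.prob_le (M : POVM d) {ρ : QState d}
    (h : ((2 : ℂ) • (maximallyMixed d).mat - ρ.mat).PosSemidef) (x : ℕ) :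
    M.prob ρ x ≤ 2 * M.prob (maximallyMixed d) x := by
  have := (Complex.le_def.1 (trace_mul_nonneg h (M.posSemidef x))).1
  rw [Matrix.sub_mul, trace_sub, Matrix.smul_mul, trace_smul, smul_eq_mul, Complex.sub_re,
    ← Complex.ofReal_ofNat, Complex.re_ofReal_mul, Complex.zero_re] at this
  simp only [POVM.prob]
  linarith

theorem POVM.ratio_le (M : POVM d) {ρ : QState d}
    (h : ((2 : ℂ) • (maximallyMixed d).mat - ρ.mat).PosSemidef) (x : ℕ) : M.ratio ρ x ≤ 2 :=
  div_le_of_le_mul₀ (M.prob_nonneg _ _) zero_le_two (M.prob_le h x)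

theorem POVM.ratio_mul_prob (M : POVM d) {ρ : QState d}
    (h : ((2 : ℂ) • (maximallyMixed d).mat - ρ.mat).PosSemidef) (x : ℕ) :
    M.ratio ρ x * M.prob (maximallyMixed d) x = M.prob ρ x := by
  rcases eq_or_ne (M.prob (maximallyMixed d) x) 0 with h0 | h0
  · have h1 := M.prob_le h x
    have h2 := M.prob_nonneg ρ x
    rw [h0] at h1 ⊢
    linarith
  · rw [POVM.ratio, div_mul_cancel₀ _ h0]

/-- The second moment of the likelihood ratios is governed by the measurement information
channel. -/
theorem POVM.integral_ratio_mul_ratio (M : POVM d) {ρ σ : QState d}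
    (hρ : ((2 : ℂ) • (maximallyMixed d).mat - ρ.mat).PosSemidef)
    (hσ : ((2 : ℂ) • (maximallyMixed d).mat - σ.mat).PosSemidef) :
    ∫ x, M.ratio ρ x * M.ratio σ x ∂(M.law (maximallyMixed d)).toMeasure =
      1 + d * M.form (ρ.mat - (maximallyMixed d).mat) (σ.mat - (maximallyMixed d).mat) := by
  have hd : (d : ℝ) ≠ 0 := Nat.cast_ne_zero.2 (NeZero.ne d)
  have hint : Integrable (fun x => M.ratio ρ x * M.ratio σ x)
      (M.law (maximallyMixed d)).toMeasure := by
    refine M.integrable_of_bounded _ _ (2 * 2) fun x => ?_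
    rw [abs_mul, abs_of_nonneg (M.ratio_nonneg ρ x), abs_of_nonneg (M.ratio_nonneg σ x)]
    exact mul_le_mul (M.ratio_le hρ x) (M.ratio_le hσ x) (M.ratio_nonneg σ x) zero_le_two
  rw [integral_countable hint]
  have hX := fun τ : QState d => τ.posSemidef.isHermitian.sub
    (maximallyMixed d).posSemidef.isHermitian
  have hform := (M.hasSum_form (hX ρ) (hX σ)).mul_left (d : ℝ)
  -- Uses $pq/r=p+q-r+(p-r)(q-r)/r$, where $r=\operatorname{Tr}M_x/d$ turns the last term into `d`
  -- times a term of the form.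
  have hs := (((M.hasSum_prob ρ).add (M.hasSum_prob σ)).sub
    (M.hasSum_prob (maximallyMixed d))).add hform
  have hval : (1 : ℝ) + 1 - 1 = 1 := by norm_num
  rw [hval] at hs
  refine (HasSum.tsum_eq ?_)
  convert hs using 1
  funext x
  rw [Measure.real, M.law_apply, ENNReal.toReal_ofReal (M.prob_nonneg _ _), smul_eq_mul]
  have hδ : ∀ τ : QState d, ((τ.mat - (maximallyMixed d).mat) * M.effect x).trace.re =
      M.prob τ x - M.prob (maximallyMixed d) x := by
    intro τ
    rw [Matrix.sub_mul, trace_sub, Complex.sub_re]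
    rfl
  rw [hδ, hδ]
  have htr : (M.effect x).trace.re = d * M.prob (maximallyMixed d) x := by
    rw [M.prob_maximallyMixed]; field_simp
  rw [htr, POVM.ratio, POVM.ratio]
  have b1 := M.prob_le hρ x
  have b2 := M.prob_le hσ x
  have b3 := M.prob_nonneg ρ x
  have b4 := M.prob_nonneg σ x
  generalize M.prob ρ x = a at *
  generalize M.prob σ x = b at *
  generalize M.prob (maximallyMixed d) x = c at *
  rcases eq_or_ne c 0 with h0 | h0
  · subst h0
    have : a = 0 := by linarith
    have : b = 0 := by linarith
    subst_vars
    simp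
  · field_simp
    ring

/-- The likelihood ratio of the outcomes of `n` measurements. -/
noncomputable def jointRatio (M : Fin n → POVM d) (ρ : QState d) (x : Fin n → ℕ) : ℝ :=
  ∏ i, (M i).ratio ρ (x i)

theorem jointRatio_nonneg (M : Fin n → POVM d) (ρ : QState d) (x : Fin n → ℕ) :
    0 ≤ jointRatio M ρ x :=
  Finset.prod_nonneg fun i _ => (M i).ratio_nonneg ρ (x i)

theorem jointRatio_le (M : Fin n → POVM d) {ρ : QState d}
    (h : ((2 : ℂ) • (maximallyMixed d).mat - ρ.mat).PosSemidef) (x : Fin n → ℕ) :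
    jointRatio M ρ x ≤ 2 ^ n := by
  calc jointRatio M ρ x ≤ ∏ _i : Fin n, (2 : ℝ) :=
        Finset.prod_le_prod (fun i _ => (M i).ratio_nonneg ρ (x i))
          fun i _ => (M i).ratio_le h (x i)
    _ = 2 ^ n := by simp

theorem outcomeLaw_eq_withDensity (M : Fin n → POVM d) {ρ : QState d}
    (h : ((2 : ℂ) • (maximallyMixed d).mat - ρ.mat).PosSemidef) :
    outcomeLaw M ρ = (outcomeLaw M (maximallyMixed d)).withDensity
      fun x => ENNReal.ofReal (jointRatio M ρ x) := by
  refine Measure.ext_of_singleton fun x => ?_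
  rw [withDensity_apply _ (measurableSet_singleton x), lintegral_singleton, outcomeLaw, outcomeLaw,
    Measure.pi_singleton, Measure.pi_singleton, jointRatio,
    ENNReal.ofReal_prod_of_nonneg fun i _ => (M i).ratio_nonneg ρ (x i), ← Finset.prod_mul_distrib]
  refine Finset.prod_congr rfl fun i _ => ?_
  rw [POVM.law_apply, POVM.law_apply, ← ENNReal.ofReal_mul ((M i).ratio_nonneg _ _),
    (M i).ratio_mul_prob h]

theorem integral_outcomeLaw (M : Fin n → POVM d) {ρ : QState d}
    (h : ((2 : ℂ) • (maximallyMixed d).mat - ρ.mat).PosSemidef) (f : (Fin n → ℕ) → ℝ) :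
    ∫ x, f x ∂outcomeLaw M ρ =
      ∫ x, jointRatio M ρ x * f x ∂outcomeLaw M (maximallyMixed d) := by
  rw [outcomeLaw_eq_withDensity M h, integral_withDensity_eq_integral_toReal_smul
    (measurable_of_countable _) (Filter.Eventually.of_forall fun x => ENNReal.ofReal_lt_top)]
  refine integral_congr_ae (Filter.Eventually.of_forall fun x => ?_)
  simp only [smul_eq_mul]
  rw [ENNReal.toReal_ofReal (jointRatio_nonneg M ρ x)]

/-- Independence factors the integral over the copies, and $1+t\le e^t$ bounds each nonnegative
factor. -/
theorem integral_jointRatio_mul_le (M : Fin n → POVM d) {ρ σ : QState d}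
    (hρ : ((2 : ℂ) • (maximallyMixed d).mat - ρ.mat).PosSemidef)
    (hσ : ((2 : ℂ) • (maximallyMixed d).mat - σ.mat).PosSemidef) :
    ∫ x, jointRatio M ρ x * jointRatio M σ x ∂outcomeLaw M (maximallyMixed d) ≤
      Real.exp (∑ i, d * (M i).form (ρ.mat - (maximallyMixed d).mat)
        (σ.mat - (maximallyMixed d).mat)) := by
  simp only [jointRatio, ← Finset.prod_mul_distrib, outcomeLaw]
  rw [integral_fintype_prod_eq_prod (𝕜 := ℝ) fun i x => (M i).ratio ρ x * (M i).ratio σ x,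
    Real.exp_sum]
  refine Finset.prod_le_prod (fun i _ => integral_nonneg fun x =>
    mul_nonneg ((M i).ratio_nonneg _ _) ((M i).ratio_nonneg _ _)) fun i _ => ?_
  rw [(M i).integral_ratio_mul_ratio hρ hσ, add_comm]
  exact Real.add_one_le_exp _

/-- Le Cam's two-point method against a mixture of states, with the chi-squared divergence bounded
through the measurement information channels. -/
theorem sum_success_le {Z : Type*} [Fintype Z] [Nonempty Z] (ρ : Z → QState d)
    (hρ : ∀ z, ((2 : ℂ) • (maximallyMixed d).mat - (ρ z).mat).PosSemidef)
    (M : Fin n → POVM d) (T : (Fin n → ℕ) → unitInterval) :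
    ∫ x, (T x : ℝ) ∂outcomeLaw M (maximallyMixed d) +
        (Fintype.card Z : ℝ)⁻¹ * ∑ z, ∫ x, (1 - (T x : ℝ)) ∂outcomeLaw M (ρ z) ≤
      7 / 6 + 3 / 2 * (((Fintype.card Z : ℝ)⁻¹) ^ 2 * ∑ z, ∑ z', Real.exp
        (∑ i, d * (M i).form ((ρ z).mat - (maximallyMixed d).mat)
          ((ρ z').mat - (maximallyMixed d).mat)) - 1) := by
  set μ := outcomeLaw M (maximallyMixed d) with hμ
  set k := (Fintype.card Z : ℝ)⁻¹ with hk
  have hcard : (Fintype.card Z : ℝ) ≠ 0 := Nat.cast_ne_zero.2 Fintype.card_ne_zero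
  have hk0 : 0 ≤ k := by positivity
  set L : (Fin n → ℕ) → ℝ := fun x => k * ∑ z, jointRatio M (ρ z) x with hL
  have hT0 : ∀ x, 0 ≤ (T x : ℝ) := fun x => (T x).2.1
  have hT1 : ∀ x, (T x : ℝ) ≤ 1 := fun x => (T x).2.2
  have habs : ∀ z x, |jointRatio M (ρ z) x| ≤ 2 ^ n := fun z x => by
    rw [abs_of_nonneg (jointRatio_nonneg _ _ _)]; exact jointRatio_le M (hρ z) x
  have hLint : ∀ f : (Fin n → ℕ) → ℝ, (∀ x, |f x| ≤ 1) → ∀ z,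
      Integrable (fun x => jointRatio M (ρ z) x * f x) μ := fun f hf z => by
    refine integrable_outcomeLaw_of_bounded M _ _ (2 ^ n * 1) fun x => ?_
    rw [abs_mul]
    exact mul_le_mul (habs z x) (hf x) (abs_nonneg _) (by positivity)
  have hTint : Integrable (fun x => (T x : ℝ)) μ :=
    integrable_outcomeLaw_of_bounded M _ _ 1 fun x => by
      rw [abs_of_nonneg (hT0 x)]; exact hT1 x
  have hfT : ∀ x, |1 - (T x : ℝ)| ≤ 1 := fun x => abs_le.2 ⟨by linarith [hT1 x], by linarith [hT0 x]⟩
  have hLLint : ∀ z z', Integrable (fun x => jointRatio M (ρ z) x * jointRatio M (ρ z') x) μ :=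
    fun z z' => by
      refine integrable_outcomeLaw_of_bounded M _ _ (2 ^ n * 2 ^ n) fun x => ?_
      rw [abs_mul]
      exact mul_le_mul (habs z x) (habs z' x) (abs_nonneg _) (by positivity)
  have e1 : k * ∑ z, ∫ x, (1 - (T x : ℝ)) ∂outcomeLaw M (ρ z) = ∫ x, L x * (1 - (T x : ℝ)) ∂μ := by
    have : ∀ x, L x * (1 - (T x : ℝ)) = k * ∑ z, jointRatio M (ρ z) x * (1 - (T x : ℝ)) :=
      fun x => by rw [hL, ← Finset.sum_mul, mul_assoc]
    simp only [this]
    rw [integral_const_mul, integral_finsetSum _ fun z _ => hLint _ hfT z]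
    simp only [integral_outcomeLaw M (hρ _), hμ]
  have hL1 : ∫ x, L x ∂μ = 1 := by
    have h1 : ∀ z, ∫ x, jointRatio M (ρ z) x ∂μ = 1 := fun z => by
      have := integral_outcomeLaw M (hρ z) fun _ => 1
      simpa using this.symm
    rw [hL, integral_const_mul, integral_finsetSum _ fun z _ => by simpa using hLint 1 (by simp) z]
    simp only [h1]
    rw [Finset.sum_const, Finset.card_univ, nsmul_eq_mul, mul_one, hk, inv_mul_cancel₀ hcard]
  have hLi : Integrable L μ :=
    (integrable_finsetSum _ fun z _ => by simpa using hLint 1 (by simp) z).const_mul _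
  have hLsq : ∀ x, L x ^ 2 = k ^ 2 * ∑ z, ∑ z', jointRatio M (ρ z) x * jointRatio M (ρ z') x := by
    intro x
    rw [hL, mul_pow, sq (∑ z, _), Finset.sum_mul_sum]
  have hL2i : Integrable (fun x => L x ^ 2) μ := by
    simp only [hLsq]
    exact (integrable_finsetSum _ fun z _ => integrable_finsetSum _ fun z' _ =>
      hLLint z z').const_mul _
  have hL2 : ∫ x, L x ^ 2 ∂μ ≤ k ^ 2 * ∑ z, ∑ z', Real.exp
        (∑ i, d * (M i).form ((ρ z).mat - (maximallyMixed d).mat)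
          ((ρ z').mat - (maximallyMixed d).mat)) := by
    simp only [hLsq]
    rw [integral_const_mul, integral_finsetSum _ fun z _ => integrable_finsetSum _ fun z' _ =>
      hLLint z z']
    refine mul_le_mul_of_nonneg_left (Finset.sum_le_sum fun z _ => ?_) (by positivity)
    rw [integral_finsetSum _ fun z' _ => hLLint z z']
    exact Finset.sum_le_sum fun z' _ => integral_jointRatio_mul_le M (hρ z) (hρ z')
  have hLT : Integrable (fun x => L x * (1 - (T x : ℝ))) μ := by
    have : ∀ x, L x * (1 - (T x : ℝ)) = k * ∑ z, jointRatio M (ρ z) x * (1 - (T x : ℝ)) :=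
      fun x => by rw [hL, ← Finset.sum_mul, mul_assoc]
    simp only [this]
    exact (integrable_finsetSum _ fun z _ => hLint _ hfT z).const_mul _
  rw [e1, ← integral_add hTint hLT]
  -- The left side is $1+(L-1)(1-T)$; by AM–GM the product is at most
  -- $\frac32(L-1)^2+\frac16(1-T)^2$. The weights keep the constant $7/6$ below the $4/3$ that a
  -- successful tester needs.
  have hpt : ∀ x, (T x : ℝ) + L x * (1 - (T x : ℝ)) ≤
      7 / 6 + 3 / 2 * (L x ^ 2 - 2 * L x + 1) := by
    intro x
    have h0 := hT0 x
    have h1 := hT1 x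
    nlinarith [sq_nonneg (3 * (L x - 1) - (1 - (T x : ℝ)))]
  have h2L : Integrable (fun x => 2 * L x) μ := hLi.const_mul 2
  have hd1 : Integrable (fun x => L x ^ 2 - 2 * L x) μ := hL2i.sub h2L
  have hd2 : Integrable (fun x => L x ^ 2 - 2 * L x + 1) μ := hd1.add (integrable_const 1)
  have hd3 : Integrable (fun x => 3 / 2 * (L x ^ 2 - 2 * L x + 1)) μ := hd2.const_mul _
  have hRi : Integrable (fun x => 7 / 6 + 3 / 2 * (L x ^ 2 - 2 * L x + 1)) μ :=
    (integrable_const _).add hd3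
  have hR : ∫ x, 7 / 6 + 3 / 2 * (L x ^ 2 - 2 * L x + 1) ∂μ =
      7 / 6 + 3 / 2 * (∫ x, L x ^ 2 ∂μ - 1) := by
    rw [integral_add (integrable_const _) hd3, integral_const_mul,
      integral_add hd1 (integrable_const 1), integral_sub hL2i h2L, integral_const_mul, hL1]
    simp
    ring
  refine (integral_mono (hTint.add hLT) hRi hpt).trans ?_
  rw [hR]
  linarith

end SecondMoment


/-! ### Random perturbations of the maximally mixed state -/

section HardFamily

open Matrix

variable {d : ℕ}

/-- The signed sum of a family of vectors. -/
noncomputable def signedSum {κ E : Type*} [Fintype κ] [AddCommGroup E] [Module ℝ E] (u : κ → E)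
    (z : κ → Bool) : E := ∑ j, boolSign (z j) • u j

theorem inner_signedSum_self {κ E : Type*} [Fintype κ] [NormedAddCommGroup E]
    [InnerProductSpace ℝ E] {u : κ → E} (hu : Orthonormal ℝ u) (z : κ → Bool) :
    inner ℝ (signedSum u z) (signedSum u z) = Fintype.card κ := by
  classical
  rw [signedSum, hu.inner_sum]
  simp [boolSign_mul_self]

theorem POVM.form_smul_signedSum (M : POVM d) {κ : Type*} [Fintype κ]
    (V : κ → Matrix (Fin d) (Fin d) ℂ) (c : ℝ) (z z' : κ → Bool) :
    M.form ((c : ℂ) • signedSum V z) ((c : ℂ) • signedSum V z') =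
      ∑ k, (∑ j, (c ^ 2 * M.form (V j) (V k)) * boolSign (z j)) * boolSign (z' k) := by
  have hs : ∀ w, (c : ℂ) • signedSum V w = ∑ j, ((c * boolSign (w j) : ℝ) : ℂ) • V j := by
    intro w
    rw [signedSum, Finset.smul_sum]
    refine Finset.sum_congr rfl fun j _ => ?_
    rw [Complex.ofReal_mul, mul_smul]
    rfl
  rw [hs, hs, POVM.form, map_sum, Matrix.mul_sum, trace_sum, Complex.re_sum]
  refine Finset.sum_congr rfl fun k _ => ?_
  rw [map_smul, Matrix.mul_smul, trace_smul, smul_eq_mul, Complex.re_ofReal_mul, Matrix.sum_mul,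
    trace_sum, Complex.re_sum, Finset.mul_sum, Finset.sum_mul]
  refine Finset.sum_congr rfl fun j _ => ?_
  rw [Matrix.smul_mul, trace_smul, smul_eq_mul, Complex.re_ofReal_mul, POVM.form]
  ring

/-- Union bound over the net: at threshold $3\sqrt d$ the tail $e^{-9d/2}\le 50^{-d}$ beats the
$25^d$ net points, leaving $2\cdot2^{-d}$, which is small since $d\ge16$. -/
theorem two_mul_pow_mul_exp_le (hd : 16 ≤ d) :
    (25 : ℝ) ^ d * (2 * Real.exp (-((3 * √d) ^ 2 / 2))) ≤ 1 / 100 := by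
  have he : (50 : ℝ) ≤ Real.exp 4 := by
    have h1 : (2.7 : ℝ) ≤ Real.exp 1 := by linarith [Real.exp_one_gt_d9]
    have h2 : Real.exp 4 = Real.exp 1 ^ 4 := by rw [← Real.exp_nat_mul]; norm_num
    rw [h2]
    calc (50 : ℝ) ≤ 2.7 ^ 4 := by norm_num
      _ ≤ _ := by gcongr
  have hexp : Real.exp (-((3 * √d) ^ 2 / 2)) ≤ (1 / 50) ^ d := by
    calc Real.exp (-((3 * √d) ^ 2 / 2)) ≤ Real.exp (d * -4) := by
          rw [mul_pow, Real.sq_sqrt (Nat.cast_nonneg d), Real.exp_le_exp]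
          have : (0 : ℝ) ≤ d := Nat.cast_nonneg d
          linarith
      _ = (Real.exp 4)⁻¹ ^ d := by rw [Real.exp_nat_mul, Real.exp_neg]
      _ ≤ (1 / 50) ^ d := by
          rw [one_div]
          gcongr
  calc _ ≤ (25 : ℝ) ^ d * (2 * (1 / 50) ^ d) := by gcongr
    _ = 2 * (1 / 2) ^ d := by
        rw [mul_left_comm, ← mul_pow]; norm_num
    _ ≤ 2 * (1 / 2) ^ 16 := by
        gcongr 2 * ?_
        exact pow_le_pow_of_le_one (by norm_num) (by norm_num) hd
    _ ≤ 1 / 100 := by norm_num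

/-- Most signed sums of an orthonormal family of Hermitian matrices have operator norm
`O(√d)`. -/
theorem exists_good_signs (hd : 16 ≤ d) {κ : Type*} [Fintype κ] [DecidableEq κ]
    {u : κ → EuclideanSpace ℝ (OffDiag d)} (hu : Orthonormal ℝ u) :
    ∃ G : Finset (κ → Bool), (99 / 100 : ℝ) * 2 ^ Fintype.card κ ≤ G.card ∧ ∀ z ∈ G,
      (((6 * √d : ℝ) : ℂ) • (1 : Matrix (Fin d) (Fin d) ℂ) - hermOf (signedSum u z)).PosSemidef ∧
      (((6 * √d : ℝ) : ℂ) • (1 : Matrix (Fin d) (Fin d) ℂ) + hermOf (signedSum u z)).PosSemidef := by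
  obtain ⟨N, hcard, hN1, hN⟩ := exists_half_net d
  let a : EuclideanSpace ℂ (Fin d) → κ → ℝ := fun φ j =>
    (star φ.ofLp ⬝ᵥ hermOf (u j) *ᵥ φ.ofLp).re
  have ha : ∀ φ z, (star φ.ofLp ⬝ᵥ hermOf (signedSum u z) *ᵥ φ.ofLp).re =
      ∑ j, a φ j * boolSign (z j) := by
    intro φ z
    rw [signedSum, map_sum, sum_mulVec, dotProduct_sum, Complex.re_sum]
    refine Finset.sum_congr rfl fun j _ => ?_
    rw [map_smul, smul_mulVec, dotProduct_smul, Complex.real_smul, Complex.re_ofReal_mul, mul_comm]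
  let bad : EuclideanSpace ℂ (Fin d) → Finset (κ → Bool) := fun φ =>
    Finset.univ.filter fun z => 3 * √d < |∑ j, a φ j * boolSign (z j)|
  have hbad : ((N.biUnion bad).card : ℝ) ≤ 1 / 100 * 2 ^ Fintype.card κ := by
    calc ((N.biUnion bad).card : ℝ) ≤ ∑ φ ∈ N, ((bad φ).card : ℝ) := by
          exact_mod_cast Finset.card_biUnion_le
      _ ≤ ∑ _φ ∈ N, 2 * (2 ^ Fintype.card κ * Real.exp (-((3 * √d) ^ 2 / 2))) :=
          Finset.sum_le_sum fun φ hφ => card_rademacher_tail_le _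
            (sum_sq_quadForm_hermOf_le hu (hN1 φ hφ)) (by positivity)
      _ = (N.card : ℝ) * (2 * Real.exp (-((3 * √d) ^ 2 / 2))) * 2 ^ Fintype.card κ := by
          rw [Finset.sum_const, nsmul_eq_mul]; ring
      _ ≤ (25 : ℝ) ^ d * (2 * Real.exp (-((3 * √d) ^ 2 / 2))) * 2 ^ Fintype.card κ := by
          gcongr
          exact_mod_cast hcard
      _ ≤ _ := by
          gcongr
          exact two_mul_pow_mul_exp_le hd
  refine ⟨(N.biUnion bad)ᶜ, ?_, fun z hz => ?_⟩
  · have htot : ((N.biUnion bad)ᶜ.card : ℝ) + (N.biUnion bad).card = 2 ^ Fintype.card κ := by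
      have := Finset.card_compl_add_card (N.biUnion bad)
      rw [Fintype.card_fun, Fintype.card_bool] at this
      exact_mod_cast this
    linarith
  · have h6 : 6 * √(d : ℝ) = 2 * (3 * √d) := by ring
    rw [h6]
    refine posSemidef_of_net (hermOf_isHermitian _) hN1 hN fun φ hφ => ?_
    rw [ha]
    by_contra! h
    refine Finset.mem_compl.1 hz (Finset.mem_biUnion.2 ⟨φ, hφ, ?_⟩)
    exact Finset.mem_filter.2 ⟨Finset.mem_univ _, h⟩

/-- A bounded traceless perturbation of the maximally mixed state with large Hilbert-Schmidt norm
is a state that is far from the maximally mixed one in trace norm. -/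
theorem exists_far_state [NeZero d] {ε : ℝ} (hε : 0 < ε) (hε' : ε ≤ 1 / 200)
    {W : Matrix (Fin d) (Fin d) ℂ} (hW : W.IsHermitian) (htr : W.trace = 0)
    (h1 : (((6 * √d : ℝ) : ℂ) • (1 : Matrix (Fin d) (Fin d) ℂ) - W).PosSemidef)
    (h2 : (((6 * √d : ℝ) : ℂ) • (1 : Matrix (Fin d) (Fin d) ℂ) + W).PosSemidef)
    (hW2 : (d : ℝ) ^ 2 ≤ 3 * (W * W).trace.re) :
    ∃ ρ : QState d,
      ρ.mat - (maximallyMixed d).mat = ((20 * ε / (d * √d) : ℝ) : ℂ) • W ∧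
      ((2 : ℂ) • (maximallyMixed d).mat - ρ.mat).PosSemidef ∧
      ε < traceNorm (ρ.mat - (maximallyMixed d).mat) := by
  have hd : (0 : ℝ) < d := Nat.cast_pos.2 (NeZero.pos d)
  have hs : 0 < √(d : ℝ) := Real.sqrt_pos.2 hd
  -- The factor 20 makes Hölder's inequality give trace norm at least $\frac{10}9\varepsilon$. The
  -- operator norm is then at most $120\varepsilon/d\le\frac{3}{5d}$, so both positivity and
  -- domination by $2\rho_{\mathrm{mm}}$ hold.
  set c : ℝ := 20 * ε / (d * √d) with hc
  have hc0 : 0 < c := by positivity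
  have hcL : c * (6 * √d) = 120 * ε / d := by rw [hc]; field_simp; norm_num
  have hcn : (0 : ℂ) ≤ (c : ℂ) := by exact_mod_cast hc0.le
  have hslack : (0 : ℂ) ≤ (((d : ℝ)⁻¹ - c * (6 * √d) : ℝ) : ℂ) := by
    rw [Complex.zero_le_real, hcL, inv_eq_one_div, ← sub_div]
    exact div_nonneg (by linarith) hd.le
  have p1 := h1.smul hcn
  have p2 := h2.smul hcn
  have hmm : (maximallyMixed d).mat =
      ((c * (6 * √d) : ℝ) : ℂ) • (1 : Matrix (Fin d) (Fin d) ℂ) +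
        (((d : ℝ)⁻¹ - c * (6 * √d) : ℝ) : ℂ) • (1 : Matrix (Fin d) (Fin d) ℂ) := by
    rw [← add_smul, ← Complex.ofReal_add, add_sub_cancel, Complex.ofReal_inv,
      Complex.ofReal_natCast]
    rfl
  have e1 : (c : ℂ) • (((6 * √d : ℝ) : ℂ) • (1 : Matrix (Fin d) (Fin d) ℂ) - W) =
      ((c * (6 * √d) : ℝ) : ℂ) • (1 : Matrix (Fin d) (Fin d) ℂ) - (c : ℂ) • W := by
    rw [smul_sub, smul_smul, ← Complex.ofReal_mul]
  have e2 : (c : ℂ) • (((6 * √d : ℝ) : ℂ) • (1 : Matrix (Fin d) (Fin d) ℂ) + W) =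
      ((c * (6 * √d) : ℝ) : ℂ) • (1 : Matrix (Fin d) (Fin d) ℂ) + (c : ℂ) • W := by
    rw [smul_add, smul_smul, ← Complex.ofReal_mul]
  rw [e1] at p1
  rw [e2] at p2
  have q1 := p1.add ((PosSemidef.one (n := Fin d) (R := ℂ)).smul hslack)
  have q2 := p2.add ((PosSemidef.one (n := Fin d) (R := ℂ)).smul hslack)
  rw [sub_add_eq_add_sub, ← hmm] at q1
  rw [add_right_comm, ← hmm] at q2
  refine ⟨⟨(maximallyMixed d).mat + (c : ℂ) • W, q2, ?_⟩, by simp, ?_, ?_⟩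
  · rw [trace_add, trace_smul, htr, (maximallyMixed d).trace_eq_one]; simp
  · have : (2 : ℂ) • (maximallyMixed d).mat - ((maximallyMixed d).mat + (c : ℂ) • W) =
        (maximallyMixed d).mat - (c : ℂ) • W := by
      rw [two_smul]; abel
    simpa only [this] using q1
  · simp only [add_sub_cancel_left]
    have hX : ((c : ℂ) • W).IsHermitian := by
      rw [IsHermitian, conjTranspose_smul, hW.eq, Complex.star_def, Complex.conj_ofReal]
    have h := trace_sq_le_mul_traceNorm hX (L := c * (6 * √d)) (by positivity) p1 p2
    rw [Matrix.smul_mul, Matrix.mul_smul, smul_smul, trace_smul, smul_eq_mul, ← Complex.ofReal_mul,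
      Complex.re_ofReal_mul] at h
    have h3 : c * c * (d ^ 2 / 3) ≤ c * (6 * √d) * traceNorm ((c : ℂ) • W) :=
      le_trans (by gcongr; linarith) h
    have h4 : c * c * (d ^ 2 / 3) = c * (6 * √d) * (10 / 9 * ε) := by
      have hsq : √(d : ℝ) * √d = d := Real.mul_self_sqrt hd.le
      rw [hc]
      field_simp
      rw [sq, hsq]
      ring
    rw [h4] at h3
    have := le_of_mul_le_mul_left h3 (by positivity)
    linarith

/-- A family of states far from maximally mixed which cannot be told apart from it by
non-adaptive measurements whose information channels have a small compression to the span of the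
perturbations. -/
theorem exists_hard_family [NeZero d] (hd : 16 ≤ d) {ε : ℝ} (hε : 0 < ε) (hε' : ε ≤ 1 / 200)
    {κ : Type} [Fintype κ] [DecidableEq κ] {u : κ → EuclideanSpace ℝ (OffDiag d)}
    (hu : Orthonormal ℝ u) (hκ : (d : ℝ) ^ 2 ≤ 3 * Fintype.card κ) :
    ∃ (Z : Type) (_ : Fintype Z) (_ : Nonempty Z) (ρ : Z → QState d),
      (∀ z, ε < traceNorm ((ρ z).mat - (maximallyMixed d).mat)) ∧
      ∀ (n : ℕ) (M : Fin n → POVM d),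
        (400 * ε ^ 2 / d ^ 2) ^ 2 *
          ∑ k, ∑ j, (∑ i, (M i).form (hermOf (u j)) (hermOf (u k))) ^ 2 ≤ 1 / 100 →
        ∀ T : (Fin n → ℕ) → unitInterval,
          ∫ x, (T x : ℝ) ∂outcomeLaw M (maximallyMixed d) +
            (Fintype.card Z : ℝ)⁻¹ * ∑ z, ∫ x, (1 - (T x : ℝ)) ∂outcomeLaw M (ρ z) ≤ 5 / 4 := by
  have hdpos : (0 : ℝ) < d := Nat.cast_pos.2 (NeZero.pos d)
  obtain ⟨G, hG, hGp⟩ := exists_good_signs hd hu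
  have hex : ∀ z : G, _ := fun z =>
    exists_far_state hε hε' (hermOf_isHermitian (signedSum u z)) (trace_hermOf _)
      (hGp z z.2).1 (hGp z z.2).2 (by
        rw [trace_hermOf_mul_hermOf, inner_signedSum_self hu]; exact hκ)
  choose ρ hρ hρ2 hρε using hex
  have hGpos : (0 : ℝ) < G.card := lt_of_lt_of_le (by positivity) hG
  have hne : G.Nonempty := Finset.card_pos.1 (Nat.cast_pos.1 hGpos)
  have : Nonempty G := hne.to_subtype
  refine ⟨G, inferInstance, inferInstance, ρ, hρε, fun n M hM T => ?_⟩
  refine (sum_success_le ρ hρ2 M T).trans ?_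
  set c : ℝ := 20 * ε / (d * √d) with hc
  have hdc : d * c ^ 2 = 400 * ε ^ 2 / d ^ 2 := by
    have hs : 0 < √(d : ℝ) := Real.sqrt_pos.2 hdpos
    rw [hc, div_pow, mul_pow, mul_pow, Real.sq_sqrt hdpos.le]
    field_simp
    norm_num
  set A : κ → κ → ℝ := fun j k =>
    400 * ε ^ 2 / d ^ 2 * ∑ i, (M i).form (hermOf (u j)) (hermOf (u k)) with hA
  have hherm : ∀ z, hermOf (signedSum u z) = signedSum (fun j => hermOf (u j)) z := fun z => by
    simp only [signedSum, map_sum, map_smul]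
  have hexpo : ∀ z z' : G, ∑ i, d * (M i).form ((ρ z).mat - (maximallyMixed d).mat)
      ((ρ z').mat - (maximallyMixed d).mat) =
      ∑ k, (∑ j, A j k * boolSign (z.1 j)) * boolSign (z'.1 k) := by
    intro z z'
    simp only [hρ, hherm, POVM.form_smul_signedSum]
    rw [← Finset.mul_sum, Finset.sum_comm, Finset.mul_sum]
    refine Finset.sum_congr rfl fun k _ => ?_
    rw [← Finset.sum_mul, Finset.sum_comm, ← mul_assoc, Finset.mul_sum]
    congr 1
    refine Finset.sum_congr rfl fun j _ => ?_
    rw [hA, ← Finset.sum_mul, ← Finset.mul_sum, ← hdc]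
    ring
  simp only [hexpo]
  have hA2 : ∑ k, ∑ j, A j k ^ 2 ≤ 1 / 100 := by
    refine le_trans (le_of_eq ?_) hM
    rw [Finset.mul_sum]
    refine Finset.sum_congr rfl fun k _ => ?_
    rw [Finset.mul_sum]
    exact Finset.sum_congr rfl fun j _ => mul_pow _ _ _
  have hch := sum_exp_chaos_le A hA2 (by norm_num)
  -- Restricting to good signs drops only positive terms; normalising by the number of good signs
  -- then costs a factor at most $(100/99)^2$.
  have hsub : ∑ z : G, ∑ z' : G,
      Real.exp (∑ k, (∑ j, A j k * boolSign (z.1 j)) * boolSign (z'.1 k)) ≤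
      (2 ^ Fintype.card κ) ^ 2 * (√(1 - 1 / 100))⁻¹ := by
    refine le_trans ?_ hch
    rw [Finset.sum_coe_sort G fun z => ∑ z' : G,
      Real.exp (∑ k, (∑ j, A j k * boolSign (z j)) * boolSign (z'.1 k))]
    refine (Finset.sum_le_sum fun z _ => ?_).trans
      (Finset.sum_le_sum_of_subset_of_nonneg (Finset.subset_univ G)
        fun z _ _ => Finset.sum_nonneg fun z' _ => (Real.exp_pos _).le)
    rw [Finset.sum_coe_sort G fun z' =>
      Real.exp (∑ k, (∑ j, A j k * boolSign (z j)) * boolSign (z' k))]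
    exact Finset.sum_le_sum_of_subset_of_nonneg (Finset.subset_univ G)
      fun z' _ _ => (Real.exp_pos _).le
  have hsqrt : (√(1 - 1 / 100 : ℝ))⁻¹ ≤ 100 / 99 := by
    have : (99 / 100 : ℝ) ≤ √(1 - 1 / 100) := Real.le_sqrt_of_sq_le (by norm_num)
    calc (√(1 - 1 / 100 : ℝ))⁻¹ ≤ (99 / 100 : ℝ)⁻¹ := by gcongr
      _ = _ := by norm_num
  have hk : ((G.card : ℝ)⁻¹) ^ 2 * (2 ^ Fintype.card κ) ^ 2 ≤ (100 / 99) ^ 2 := by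
    rw [← mul_pow]
    gcongr
    rw [inv_mul_le_iff₀ hGpos]
    linarith
  rw [Fintype.card_coe]
  have hfin : ((G.card : ℝ)⁻¹) ^ 2 * ∑ z : G, ∑ z' : G,
      Real.exp (∑ k, (∑ j, A j k * boolSign (z.1 j)) * boolSign (z'.1 k)) ≤
      (100 / 99) ^ 2 * (100 / 99) := by
    calc _ ≤ ((G.card : ℝ)⁻¹) ^ 2 * ((2 ^ Fintype.card κ) ^ 2 * (√(1 - 1 / 100))⁻¹) := by gcongr
      _ = ((G.card : ℝ)⁻¹) ^ 2 * (2 ^ Fintype.card κ) ^ 2 * (√(1 - 1 / 100))⁻¹ := by ring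
      _ ≤ _ := by gcongr
  norm_num at hfin ⊢
  linarith

end HardFamily


/-! ### The two lower bounds -/

section LowerBounds

open Matrix

variable {d : ℕ}

/-- The constant $5/6$ leaves $d^2/3$ directions after at most $d^2/2$ are discarded in the fixed
case. -/
theorem three_mul_card_offDiag (hd : 16 ≤ d) :
    5 / 6 * (d : ℝ) ^ 2 + 3 * d / 2 ≤ Fintype.card (OffDiag d) := by
  rw [card_offDiag, Nat.cast_sub (Nat.le_mul_self d)]
  push_cast
  have : (16 : ℝ) ≤ d := by exact_mod_cast hd
  nlinarith

theorem hermOf_single (p : OffDiag d) :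
    hermOf (EuclideanSpace.basisFun (OffDiag d) ℝ p) = hermUnit p.1 := by
  rw [hermOf_apply, Finset.sum_eq_single p]
  · simp
  · intro q _ hq
    simp [hq]
  · simp

variable [NeZero d]

/-- The standard Hermitian units serve every seed at once. For each seed Cauchy–Schwarz over the
copies bounds the chaos matrix, and averaging the resulting $5/4$ over seeds contradicts $2/3+2/3$.
-/
theorem RandomizedTestable.le_mul {𝔐 : Set (POVM d)} {ε S : ℝ} {n : ℕ} (hd : 16 ≤ d)
    (hε : 0 < ε) (hε' : ε ≤ 1 / 200) (hS : ∀ M ∈ 𝔐, M.channelHsNorm ≤ S)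
    (h : RandomizedTestable 𝔐 ε n) : (d : ℝ) ^ 2 / 8000 ≤ n * (ε ^ 2 * S) := by
  by_contra! hlt
  have hdpos : (0 : ℝ) < d := Nat.cast_pos.2 (NeZero.pos d)
  obtain ⟨Z, _, _, ρ, hρ, hfam⟩ := exists_hard_family hd hε hε'
    (EuclideanSpace.basisFun (OffDiag d) ℝ).orthonormal (by
      have := three_mul_card_offDiag hd
      nlinarith)
  obtain ⟨Ω, _, P, _, M, T, hM, -, -, h0, h1⟩ := h
  have hpt : ∀ ω, ∫ x, (T ω x : ℝ) ∂outcomeLaw (M ω) (maximallyMixed d) +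
      (Fintype.card Z : ℝ)⁻¹ * ∑ z, ∫ x, (1 - (T ω x : ℝ)) ∂outcomeLaw (M ω) (ρ z) ≤ 5 / 4 := by
    intro ω
    refine hfam n (M ω) ?_ (T ω)
    simp only [hermOf_single]
    have hnn : ∀ i, 0 ≤ (M ω i).channelHsNorm := fun i => Real.sqrt_nonneg _
    have hsum : ∑ k : OffDiag d, ∑ j : OffDiag d,
        (∑ i, (M ω i).form (hermUnit j.1) (hermUnit k.1)) ^ 2 ≤ (n * S) ^ 2 := by
      calc _ ≤ ∑ k : OffDiag d, ∑ j : OffDiag d,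
            n * ∑ i, (M ω i).form (hermUnit j.1) (hermUnit k.1) ^ 2 := by
            gcongr with k _ j _
            simpa using sq_sum_le_card_mul_sum_sq (s := Finset.univ)
              (f := fun i => (M ω i).form (hermUnit j.1) (hermUnit k.1))
        _ = n * ∑ i, ∑ j : OffDiag d, ∑ k : OffDiag d,
            (M ω i).form (hermUnit j.1) (hermUnit k.1) ^ 2 := by
            rw [Finset.sum_comm]
            simp only [← Finset.mul_sum]
            congr 1
            exact (Finset.sum_congr rfl fun j _ => Finset.sum_comm).trans Finset.sum_comm
        _ ≤ n * ∑ _i : Fin n, S ^ 2 := by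
            gcongr with i _
            refine (M ω i).sum_form_sq_le.trans ?_
            have := hnn i
            have := hS _ (hM ω i)
            gcongr
        _ = _ := by simp; ring
    have hnS : 0 ≤ n * S := by
      rcases Nat.eq_zero_or_pos n with rfl | hn
      · simp
      · exact mul_nonneg (Nat.cast_nonneg n) ((hnn ⟨0, hn⟩).trans (hS _ (hM ω _)))
    calc _ ≤ (400 * ε ^ 2 / d ^ 2) ^ 2 * (n * S) ^ 2 := by gcongr
      _ = (400 * (n * (ε ^ 2 * S)) / d ^ 2) ^ 2 := by ring
      _ ≤ (1 / 10) ^ 2 := by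
          have h0 : 0 ≤ (n : ℝ) * (ε ^ 2 * S) := by
            have : (n : ℝ) * (ε ^ 2 * S) = ε ^ 2 * (n * S) := by ring
            rw [this]; positivity
          refine pow_le_pow_left₀ (by positivity) ?_ 2
          rw [div_le_iff₀ (by positivity)]
          linarith [sq_nonneg (d : ℝ)]
      _ = 1 / 100 := by norm_num
  -- A non-integrable function has integral 0 by convention, so the success bounds themselves force
  -- integrability in the seed.
  have hint : ∀ f : Ω → ℝ, 2 / 3 ≤ ∫ ω, f ω ∂P → Integrable f P := by
    intro f hf
    by_contra hn
    rw [integral_undef hn] at hf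
    norm_num at hf
  have hi0 := hint _ h0
  have hi1 := fun z => hint _ (h1 (ρ z) (hρ z))
  have hsumi := (integrable_finsetSum Finset.univ fun z _ => hi1 z).const_mul
    (Fintype.card Z : ℝ)⁻¹
  have hle := integral_mono (hi0.add hsumi) (integrable_const (5 / 4 : ℝ)) hpt
  have heq : ∫ ω, (∫ x, (T ω x : ℝ) ∂outcomeLaw (M ω) (maximallyMixed d) +
      (Fintype.card Z : ℝ)⁻¹ * ∑ z, ∫ x, (1 - (T ω x : ℝ)) ∂outcomeLaw (M ω) (ρ z)) ∂P =
      ∫ ω, ∫ x, (T ω x : ℝ) ∂outcomeLaw (M ω) (maximallyMixed d) ∂P +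
      (Fintype.card Z : ℝ)⁻¹ *
        ∑ z, ∫ ω, ∫ x, (1 - (T ω x : ℝ)) ∂outcomeLaw (M ω) (ρ z) ∂P := by
    rw [integral_add hi0 hsumi, integral_const_mul, integral_finsetSum _ fun z _ => hi1 z]
  change ∫ ω, (∫ x, (T ω x : ℝ) ∂outcomeLaw (M ω) (maximallyMixed d) +
      (Fintype.card Z : ℝ)⁻¹ * ∑ z, ∫ x, (1 - (T ω x : ℝ)) ∂outcomeLaw (M ω) (ρ z)) ∂P ≤ _ at hle
  rw [heq] at hle
  have havg : 2 / 3 ≤ (Fintype.card Z : ℝ)⁻¹ *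
      ∑ z, ∫ ω, ∫ x, (1 - (T ω x : ℝ)) ∂outcomeLaw (M ω) (ρ z) ∂P := by
    have hc : (0 : ℝ) < Fintype.card Z := Nat.cast_pos.2 Fintype.card_pos
    rw [le_inv_mul_iff₀ hc]
    have := Finset.sum_le_sum fun z (_ : z ∈ Finset.univ) => h1 (ρ z) (hρ z)
    simpa using this
  simp at hle
  linarith

/-- In an eigenbasis of the summed forms the chaos matrix is diagonal. Keeping only eigenvalues at
most twice the trace bound over $d^2$ makes its Hilbert–Schmidt norm a matter of the trace alone. -/
theorem FixedTestable.le_mul {𝔐 : Set (POVM d)} {ε S : ℝ} {n : ℕ} (hd : 16 ≤ d)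
    (hε : 0 < ε) (hε' : ε ≤ 1 / 200) (hS : ∀ M ∈ 𝔐, M.channelTraceNorm ≤ S)
    (h : FixedTestable 𝔐 ε n) : (d : ℝ) ^ 3 / 8000 ≤ n * (ε ^ 2 * S) := by
  by_contra! hlt
  have hdpos : (0 : ℝ) < d := Nat.cast_pos.2 (NeZero.pos d)
  obtain ⟨M, T, hM, h0, h1⟩ := h
  -- The constant 8000 is tuned here: with at most $d^2$ eigenvalues, each at most $2B/d^2$, the
  -- squared norm bound comes out as exactly $1/100$.
  set B : ℝ := d ^ 3 / 8000 / ε ^ 2 with hB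
  have hBpos : 0 < B := by positivity
  have hnS : n * S ≤ B := by
    rw [hB, le_div_iff₀ (by positivity)]
    linarith
  set A : Matrix (OffDiag d) (OffDiag d) ℝ :=
    Matrix.of fun p q => ∑ i, (M i).form (hermUnit p.1) (hermUnit q.1) with hAdef
  have hA : A.IsHermitian := by
    ext p q
    simp only [hAdef, conjTranspose_apply, of_apply, star_trivial]
    exact Finset.sum_congr rfl fun i _ =>
      (M i).form_symm (hermUnit_isHermitian _) (hermUnit_isHermitian _)
  set b := hA.eigenvectorBasis with hb
  have hbil : ∀ u v : EuclideanSpace ℝ (OffDiag d),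
      ∑ i, (M i).form (hermOf u) (hermOf v) = u.ofLp ⬝ᵥ A *ᵥ v.ofLp := by
    intro u v
    have hf : ∀ i, (M i).form (hermOf u) (hermOf v) =
        ∑ p, ∑ q, u p * ((M i).form (hermUnit p.1) (hermUnit q.1) * v q) := by
      intro i
      rw [POVM.form, hermOf_apply, hermOf_apply, map_sum, Matrix.sum_mul, trace_sum,
        Complex.re_sum]
      refine Finset.sum_congr rfl fun p _ => ?_
      rw [Matrix.mul_sum, trace_sum, Complex.re_sum]
      refine Finset.sum_congr rfl fun q _ => ?_
      rw [map_smul, Matrix.smul_mul, Matrix.mul_smul, trace_smul, trace_smul, smul_eq_mul,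
        smul_eq_mul, Complex.re_ofReal_mul, Complex.re_ofReal_mul, POVM.form]
      ring
    simp only [hf, dotProduct, mulVec, hAdef, of_apply]
    rw [Finset.sum_comm]
    refine Finset.sum_congr rfl fun p _ => ?_
    rw [Finset.sum_comm, Finset.mul_sum]
    refine Finset.sum_congr rfl fun q _ => ?_
    rw [Finset.sum_mul, Finset.mul_sum]
  have hdiag : ∀ j k, ∑ i, (M i).form (hermOf (b j)) (hermOf (b k)) =
      if j = k then hA.eigenvalues k else 0 := by
    intro j k
    have := orthonormal_iff_ite.1 b.orthonormal k j
    rw [EuclideanSpace.inner_eq_star_dotProduct, star_trivial] at this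
    rw [hbil, hb, hA.mulVec_eigenvectorBasis, dotProduct_smul, ← hb, this]
    simp [eq_comm]
  have hnn : ∀ j, 0 ≤ hA.eigenvalues j := by
    intro j
    have := hdiag j j
    rw [if_pos rfl] at this
    rw [← this]
    exact Finset.sum_nonneg fun i _ => (M i).form_self_nonneg (hermOf_isHermitian _)
  have htr : ∑ j, hA.eigenvalues j ≤ B := by
    have := hA.trace_eq_sum_eigenvalues
    simp only [RCLike.ofReal_real_eq_id, id_eq] at this
    rw [← this, trace]
    simp only [diag_apply, hAdef, of_apply]
    rw [Finset.sum_comm]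
    refine le_trans ?_ hnS
    calc _ ≤ ∑ _i : Fin n, S := Finset.sum_le_sum fun i _ =>
          (M i).sum_form_self_le.trans (hS _ (hM i))
      _ = n * S := by simp
  set J : OffDiag d → Prop := fun j => hA.eigenvalues j ≤ 2 * B / d ^ 2 with hJ
  classical
  have hJcard : (d : ℝ) ^ 2 ≤ 3 * Fintype.card {j // J j} := by
    -- Markov's inequality: the eigenvalues are nonnegative with sum at most `B`, so at most $d^2/2$
    -- of them exceed $2B/d^2$.
    have hbig : (Fintype.card {j // ¬ J j} : ℝ) * (2 * B / d ^ 2) ≤ B := by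
      refine le_trans ?_ htr
      rw [Fintype.card_subtype, ← nsmul_eq_mul, ← Finset.sum_const]
      refine (Finset.sum_le_sum fun j hj => ?_).trans
        (Finset.sum_le_sum_of_subset_of_nonneg (Finset.filter_subset _ _) fun j _ _ => hnn j)
      exact (not_le.1 (Finset.mem_filter.1 hj).2).le
    have hle : (Fintype.card {j // ¬ J j} : ℝ) ≤ d ^ 2 / 2 := by
      have e : (d : ℝ) ^ 2 / 2 * (2 * B / d ^ 2) = B := by field_simp
      refine le_of_mul_le_mul_right (hbig.trans (le_of_eq e.symm)) (by positivity)
    have hc := Fintype.card_subtype_compl J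
    have hle' := Fintype.card_subtype_le J
    have hcard := three_mul_card_offDiag hd
    have hcast : (Fintype.card {j // ¬ J j} : ℝ) =
        Fintype.card (OffDiag d) - Fintype.card {j // J j} := by
      rw [hc, Nat.cast_sub hle']
    rw [hcast] at hle
    linarith
  obtain ⟨Z, _, _, ρ, hρ, hfam⟩ := exists_hard_family hd hε hε'
    (b.orthonormal.comp (fun j : {j // J j} => j.1) Subtype.val_injective) hJcard
  have hsum : (400 * ε ^ 2 / d ^ 2) ^ 2 * ∑ k : {j // J j}, ∑ j : {j // J j},
      (∑ i, (M i).form (hermOf (b j.1)) (hermOf (b k.1))) ^ 2 ≤ 1 / 100 := by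
    have hin : ∀ k : {j // J j}, ∑ j : {j // J j},
        (∑ i, (M i).form (hermOf (b j.1)) (hermOf (b k.1))) ^ 2 ≤ (2 * B / d ^ 2) ^ 2 := by
      intro k
      rw [Finset.sum_eq_single k]
      · rw [hdiag, if_pos rfl]
        have := hnn k.1
        have := k.2
        simp only [hJ] at this
        gcongr
      · intro j _ hj
        rw [hdiag, if_neg fun h => hj (Subtype.ext h)]
        norm_num
      · simp
    have hcard : (Fintype.card {j // J j} : ℝ) ≤ d ^ 2 := by
      have h1 := Fintype.card_subtype_le J
      rw [card_offDiag] at h1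
      have h2 : Fintype.card {j // J j} ≤ d ^ 2 := by
        exact h1.trans ((Nat.sub_le _ _).trans (sq d).ge)
      exact_mod_cast h2
    calc _ ≤ (400 * ε ^ 2 / d ^ 2) ^ 2 * ∑ _k : {j // J j}, (2 * B / (d : ℝ) ^ 2) ^ 2 := by
          gcongr with k _
          exact hin k
      _ = (400 * ε ^ 2 / d ^ 2) ^ 2 * (Fintype.card {j // J j} * (2 * B / (d : ℝ) ^ 2) ^ 2) := by
          simp
      _ ≤ (400 * ε ^ 2 / d ^ 2) ^ 2 * (d ^ 2 * (2 * B / (d : ℝ) ^ 2) ^ 2) := by gcongr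
      _ = 1 / 100 := by
          rw [hB]
          field_simp
          norm_num
  have hle := hfam n M hsum T
  have havg : 2 / 3 ≤ (Fintype.card Z : ℝ)⁻¹ *
      ∑ z, ∫ x, (1 - (T x : ℝ)) ∂outcomeLaw M (ρ z) := by
    have hc : (0 : ℝ) < Fintype.card Z := Nat.cast_pos.2 Fintype.card_pos
    rw [le_inv_mul_iff₀ hc]
    have := Finset.sum_le_sum fun z (_ : z ∈ Finset.univ) => h1 (ρ z) (hρ z)
    simpa using this
  linarith

theorem le_toENNReal_iInf {P : ℕ → Prop} {a : ℝ≥0∞} (h : ∀ n, P n → a ≤ n) :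
    a ≤ ((⨅ (n : ℕ) (_ : P n), (n : ℕ∞) : ℕ∞) : ℝ≥0∞) := by
  simp only [ENat.toENNReal_iInf, ENat.toENNReal_coe]
  exact le_iInf₂ h

theorem le_toReal_iSup {α : Type*} {s : Set α} {f : α → ℝ}
    (htop : ⨆ x ∈ s, ENNReal.ofReal (f x) ≠ ⊤) {x : α} (hx : x ∈ s) :
    f x ≤ (⨆ x ∈ s, ENNReal.ofReal (f x)).toReal :=
  (ENNReal.ofReal_le_iff_le_toReal htop).1 (le_iSup₂ (f := fun x _ => ENNReal.ofReal (f x)) x hx)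

end LowerBounds

end MixTest

theorem theorem4 :
    ∃ c : ℝ, 0 < c ∧
      ∀ (d : ℕ) [NeZero d] (𝔐 : Set (MixTest.POVM d)) (ε : ℝ),
        16 ≤ d → 0 < ε → ε ≤ 1 / 200 →
        ENNReal.ofReal c * ((d : ℝ≥0∞) ^ 2 /
            (ENNReal.ofReal ε ^ 2 * ⨆ M ∈ 𝔐, ENNReal.ofReal M.channelHsNorm))
          ≤ (MixTest.randomizedCopyComplexity 𝔐 ε : ℝ≥0∞) ∧
        ENNReal.ofReal c * ((d : ℝ≥0∞) ^ 2 / ENNReal.ofReal ε ^ 2 *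
            ((d : ℝ≥0∞) / ⨆ M ∈ 𝔐, ENNReal.ofReal M.channelTraceNorm))
          ≤ (MixTest.fixedCopyComplexity 𝔐 ε : ℝ≥0∞) := by
  refine ⟨1 / 8000, by norm_num, fun d _ 𝔐 ε hd hε hε' => ?_⟩
  have hε0 : ENNReal.ofReal ε ^ 2 ≠ 0 := pow_ne_zero _ (ENNReal.ofReal_pos.2 hε).ne'
  have hεt : ENNReal.ofReal ε ^ 2 ≠ ⊤ := ENNReal.pow_ne_top ENNReal.ofReal_ne_top
  have key : ∀ (m n : ℕ) (S : ℝ≥0∞), (S ≠ ⊤ → (d : ℝ) ^ m / 8000 ≤ n * (ε ^ 2 * S.toReal)) →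
      ENNReal.ofReal (1 / 8000) * ((d : ℝ≥0∞) ^ m / (ENNReal.ofReal ε ^ 2 * S)) ≤ n := by
    intro m n S h
    -- An infinite supremum makes the left side 0, so real-valued bounds are needed only when it is
    -- finite.
    by_cases hS : S = ⊤
    · rw [hS, ENNReal.mul_top hε0, ENNReal.div_top, mul_zero]
      exact zero_le
    · rw [← mul_div_assoc]
      refine ENNReal.div_le_of_le_mul ?_
      have h1 := ENNReal.ofReal_le_ofReal (h hS)
      rw [ENNReal.ofReal_mul (Nat.cast_nonneg n), ENNReal.ofReal_mul (sq_nonneg ε),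
        ENNReal.ofReal_toReal hS, ENNReal.ofReal_natCast, ENNReal.ofReal_pow hε.le,
        div_eq_mul_one_div, mul_comm, ENNReal.ofReal_mul (by norm_num),
        ENNReal.ofReal_pow (Nat.cast_nonneg d), ENNReal.ofReal_natCast] at h1
      exact h1
  constructor
  · refine MixTest.le_toENNReal_iInf fun n hn => key 2 n _ fun hS => ?_
    exact hn.le_mul hd hε hε' fun M hM => MixTest.le_toReal_iSup hS hM
  · refine MixTest.le_toENNReal_iInf fun n hn => ?_
    have := key 3 n _ fun hS =>
      hn.le_mul hd hε hε' fun M hM => MixTest.le_toReal_iSup (f := MixTest.POVM.channelTraceNorm) hS hM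
    refine le_trans (le_of_eq ?_) this
    rw [div_eq_mul_inv _ (ENNReal.ofReal ε ^ 2 * _), ENNReal.mul_inv (Or.inl hε0) (Or.inl hεt),
      div_eq_mul_inv (_ ^ 2), div_eq_mul_inv (d : ℝ≥0∞)]
    ring
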